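/- **Theorem 1.2.** Let $d,m\ge 1$ and let $T_1,\dots,T_m$ be invertible real $d\times d$ matrices with $\|T_i\|<1/2$ for $1\le i\le m$, where $\|\cdot\|$ is the operator norm for the Euclidean norm on $\mathbb R^d$. Let $\Sigma=\{1,\dots,m\}^{\mathbb N}$ with the product topology, and let $\mu$ be a Borel probability measure on $\Sigma$. *Notation.* For $\mathbf a=(a_1,\dots,a_m)\in(\mathbb R^{d})^m=\mathbb R^{md}$ put $f_i^{\mathbf a}(v)=T_iv+a_i$, let $\pi^{\mathbf a}(x)=\lim_{n\to\infty}f^{\mathbf a}_{x_1}\circ\cdots\circ f^{\mathbf a}_{x_n}(0)$ for $x=(x_i)_{i\ge1}\in\Sigma$, and let $\pi^{\mathbf a}_*\mu$ be the push-forward of $\mu$ by $\pi^{\mathbf a}$. A Borel probability measure $\eta$ on $\mathbb R^d$ is *exact dimensional* if there is a constant $C$ with $\lim_{r\to0^+}\frac{\log\eta(B(x,r))}{\log r}=C$ for $\eta$-a.e. $x$, where $B(x,r)$ is the closed ball. Let $\alpha_1(T)\ge\dots\ge\alpha_d(T)$ be the singular values of a $d\times d$ matrix $T$. For $T$ invertible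 put $$\phi^s(T)=\begin{cases}\alpha_1(T)\cdots\alpha_k(T)\,\alpha_{k+1}(T)^{s-k}, & 0\le s<d,\ k=\lfloor s\rfloor,\\ |\det T|^{s/d}, & d\le s<\infty,\end{cases}\qquad \phi^\infty(T)=0 .$$ For $x\in\Sigma$ write $T_{x|n}=T_{x_1}\cdots T_{x_n}$ (with $T_{x|0}$ the identity matrix) and $[x|n]=\{y\in\Sigma: y_i=x_i \text{ for } 1\le i\le n\}$. For $n\ge1$ let $S_n(\mu,x)$ be the unique $t\in[0,\infty]$ with $\phi^t(T_{x|n})=\mu([x|n])$. For $x,y\in\Sigma$ and $r>0$ let $$Z_{x\wedge y}(r)=\prod_{k=1}^d\frac{\min\{r,\alpha_k(T_{x|j})\}}{\alpha_k(T_{x|j})}$$ if $x\ne y$, where $j\ge 0$ is the length of the longest common initial segment of $x$ and $y$, and let $Z_{x\wedge y}(r)=1$ if $x=y$. Put $G_\mu(x,r)=\int Z_{x\wedge y}(r)\,d\mu(y)$. *Claim.* The measure $\pi^{\mathbf a}_*\mu$ is exact dimensional for Lebesgue-a.e. $\mathbf a\in\mathbb R^{md}$ if and only if one of the following two conditions holds: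 1. $\liminf_{n\to\infty}S_n(\mu,x)\ge d$ for $\mu$-a.e. $x\in\Sigma$; 2. there is $s\in[0,d)$ such that, for $\mu$-a.e. $x\in\Sigma$, $\liminf_{n\to\infty}S_n(\mu,x)=s$ and $\limsup_{r\to0^+}\frac{\log G_\mu(x,r)}{\log r}=s$. -/

import Mathlib

open MeasureTheory Filter Topology
open scoped ENNReal

namespace SelfAffine

noncomputable section

/-- The Euclidean space `ℝ^d`. -/
abbrev E (d : ℕ) : Type := EuclideanSpace ℝ (Fin d)

/-- The one-sided symbolic space over `m` letters, with the product topology and its Borel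
`σ`-algebra. Letters and positions are numbered from `0`. -/
abbrev Shift (m : ℕ) : Type := ℕ → Fin m

/-- The cylinder `[x|n]` of all sequences that agree with `x` in the first `n` letters. -/
def cyl {m : ℕ} (x : Shift m) (n : ℕ) : Set (Shift m) :=
  PiNat.cylinder (E := fun _ => Fin m) x n

/-- The operator norm of a square matrix for the Euclidean norm of `ℝ^d`. -/
def opNorm {d : ℕ} (M : Matrix (Fin d) (Fin d) ℝ) : ℝ :=
  ‖Matrix.toEuclideanCLM (n := Fin d) (𝕜 := ℝ) M‖

/-- The singular values `α_0 ≥ α_1 ≥ ... ≥ α_(d-1)` of a `d × d` matrix (numbered from `0`). -/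
def sv {d : ℕ} (M : Matrix (Fin d) (Fin d) ℝ) (k : ℕ) : ℝ :=
  (Matrix.toEuclideanLin M).singularValues k

/-- The singular value function `φ^s(M)`, for real `s ≥ 0`. -/
def svFun {d : ℕ} (s : ℝ) (M : Matrix (Fin d) (Fin d) ℝ) : ℝ :=
  if s < d then (∏ i ∈ Finset.range ⌊s⌋₊, sv M i) * sv M ⌊s⌋₊ ^ (s - ⌊s⌋₊)
  else |M.det| ^ (s / d)

/-- The singular value function with exponent in `[0, ∞]`, where `φ^∞(M) = 0`. -/
def svFunExt {d : ℕ} (s : ℝ≥0∞) (M : Matrix (Fin d) (Fin d) ℝ) : ℝ :=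
  if s = ⊤ then 0 else svFun s.toReal M

section IFS

variable {d m : ℕ}

/-- The matrix `T_{x|n}`, the product of `T (x 0)`, ..., `T (x (n - 1))` in this order; it is the
identity for `n = 0`. -/
def wordMat (T : Fin m → Matrix (Fin d) (Fin d) ℝ) (x : Shift m) : ℕ → Matrix (Fin d) (Fin d) ℝ
  | 0 => 1
  | n + 1 => wordMat T x n * T (x n)

/-- The affine map `f_i(v) = T_i v + a_i`. -/
def affMap (T : Fin m → Matrix (Fin d) (Fin d) ℝ) (a : Fin m → E d) (i : Fin m) (v : E d) : E d :=
  Matrix.toEuclideanLin (T i) v + a i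

/-- The composition `f_{x 0} ∘ ... ∘ f_{x (n - 1)}`. -/
def wordMap (T : Fin m → Matrix (Fin d) (Fin d) ℝ) (a : Fin m → E d) (x : Shift m) :
    ℕ → E d → E d
  | 0 => id
  | n + 1 => wordMap T a x n ∘ affMap T a (x n)

/-- The coding map `π^a(x) = lim_n f_{x 0} ∘ ... ∘ f_{x (n - 1)} (0)`. The limit exists for all `x`
when the matrices are contracting. -/
def coding (T : Fin m → Matrix (Fin d) (Fin d) ℝ) (a : Fin m → E d) (x : Shift m) : E d :=
  limUnder atTop fun n : ℕ => wordMap T a x n 0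

/-- `S_n(μ, x)`, the number `t ∈ [0, ∞]` with `φ^t(T_{x|n}) = μ([x|n])`. For `n ≥ 1` and
contracting invertible matrices there is exactly one such `t`, so that the infimum is over
a singleton. -/
def S (T : Fin m → Matrix (Fin d) (Fin d) ℝ) (μ : Measure (Shift m)) (n : ℕ) (x : Shift m) :
    ℝ≥0∞ :=
  sInf {t : ℝ≥0∞ | svFunExt t (wordMat T x n) = μ.real (cyl x n)}

open scoped Classical in
/-- `Z_{x∧y}(r)`. For `x ≠ y`, `PiNat.firstDiff x y` is the length of the common initial
segment `x ∧ y`, so that `wordMat T x (PiNat.firstDiff x y)` is `T_{x∧y}`. -/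
def Z (T : Fin m → Matrix (Fin d) (Fin d) ℝ) (x y : Shift m) (r : ℝ) : ℝ :=
  if x = y then 1
  else ∏ k ∈ Finset.range d,
    min r (sv (wordMat T x (PiNat.firstDiff (E := fun _ => Fin m) x y)) k) /
      sv (wordMat T x (PiNat.firstDiff (E := fun _ => Fin m) x y)) k

/-- `G_μ(x, r) = ∫ Z_{x∧y}(r) dμ(y)`. -/
def G (T : Fin m → Matrix (Fin d) (Fin d) ℝ) (μ : Measure (Shift m)) (x : Shift m) (r : ℝ) : ℝ :=
  ∫ y, Z T x y r ∂μ

/-- `D(μ, x) = limsup_{r → 0} log G_μ(x, r) / log r`. -/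
def D (T : Fin m → Matrix (Fin d) (Fin d) ℝ) (μ : Measure (Shift m)) (x : Shift m) : EReal :=
  limsup (fun r : ℝ => ((Real.log (G T μ x r) / Real.log r : ℝ) : EReal)) (𝓝[>] 0)

end IFS

/-- The quotient `log η(B(x, r)) / log r` with the closed ball `B(x, r)`, where `log 0 = -∞`. -/
def logRatio {d : ℕ} (η : Measure (E d)) (x : E d) (r : ℝ) : EReal :=
  ENNReal.log (η (Metric.closedBall x r)) / ((Real.log r : ℝ) : EReal)

/-- The lower local dimension of `η` at `x`. -/
def lowerLocDim {d : ℕ} (η : Measure (E d)) (x : E d) : EReal :=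
  liminf (logRatio η x) (𝓝[>] 0)

/-- The upper local dimension of `η` at `x`. -/
def upperLocDim {d : ℕ} (η : Measure (E d)) (x : E d) : EReal :=
  limsup (logRatio η x) (𝓝[>] 0)

/-- `η` is exact dimensional: for some constant `C` the local dimension exists and equals `C` at
`η`-almost every point. -/
def ExactDimensional {d : ℕ} (η : Measure (E d)) : Prop :=
  ∃ C : ℝ, ∀ᵐ x ∂η, lowerLocDim η x = (C : EReal) ∧ upperLocDim η x = (C : EReal)

end

end SelfAffine

namespace SelfAffine

noncomputable section

/-! ### Singular values, the covering weight `zfun`, and the singular value function -/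

section SingularValues

variable {d : ℕ}

/-! The local dimensions of the projected measure at typical points are determined by the potential
`G`. For almost every `a` and `μ`-almost every `x`, the mass of the ball of radius `r = 2^(-n)`
around the coded point of `x` agrees with `G T μ x r` up to factors polynomial in `n`
(`ae_ae_eventually_measure_near_comparable`). Such factors vanish in `log / log r`, so the lower and
upper local dimensions are the liminf and the limsup of `log G / log r` (`ae_ae_locDim_eq`). Neither
depends on `a`. The limsup is `D`, which is at most `d`, and the liminf is the minimum of `d` and
`liminf S_n` (`liminf_logG_eq`). Exact dimensionality thus says that both equal one constant almost
everywhere: the value `d` gives the first condition, a smaller value the second.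

The upper bound for balls rests on transversality (`exists_volume_coding_sub_le`). After the common
prefix of `x` and `y` is removed, moving one suitable translation vector moves the difference of the
two coded points at a rate at least `1 - ρ / (1 - ρ)`, which is positive because `ρ < 1/2`. Hence
the bounded parameters that bring the two coded points within `r` have volume at most a constant
times `zfun (T_{x∧y}) r`. Integration over `y` and Borel–Cantelli bound the mass of balls by the
dyadic sum `H`, which is `G` up to a factor `n + 1`.

The lower bound holds for every `a` (`ae_eventually_H_le`). The image of a cylinder `[x|j]` is cut
into about `1 / zfun (T_{x|j}) r` cells of diameter at most `r`. Points whose ball has much less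
than the average mass of a cell have small total measure, and Borel–Cantelli applies again.

The liminf is computed from `zfun M r * svFun s M ≤ r ^ s`, with equality at the radius `r = sv M
⌊s⌋₊`. The inequality turns `μ [x|n] ≤ φ^t` for large `n` into an upper bound of `G` at all scales;
equality turns `μ [x|n] ≥ φ^t` for infinitely many `n` into a lower bound at a sequence of radii. -/

lemma norm_toEuclideanLin_le (M : Matrix (Fin d) (Fin d) ℝ) (v : E d) :
    ‖Matrix.toEuclideanLin M v‖ ≤ opNorm M * ‖v‖ :=
  (Matrix.toEuclideanCLM (n := Fin d) (𝕜 := ℝ) M).le_opNorm v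

lemma opNorm_nonneg (M : Matrix (Fin d) (Fin d) ℝ) : 0 ≤ opNorm M := norm_nonneg _

lemma opNorm_mul_le (A B : Matrix (Fin d) (Fin d) ℝ) : opNorm (A * B) ≤ opNorm A * opNorm B := by
  unfold opNorm
  rw [map_mul]
  exact norm_mul_le _ _

lemma opNorm_one_le : opNorm (1 : Matrix (Fin d) (Fin d) ℝ) ≤ 1 := by
  unfold opNorm
  rw [map_one]
  exact ContinuousLinearMap.norm_id_le

lemma toEuclideanLin_mul (A B : Matrix (Fin d) (Fin d) ℝ) (v : E d) :
    Matrix.toEuclideanLin (A * B) v = Matrix.toEuclideanLin A (Matrix.toEuclideanLin B v) := by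
  change Matrix.toEuclideanCLM (n := Fin d) (𝕜 := ℝ) (A * B) v = _
  rw [map_mul]
  rfl

lemma toEuclideanLin_one (v : E d) :
    Matrix.toEuclideanLin (1 : Matrix (Fin d) (Fin d) ℝ) v = v := by
  change Matrix.toEuclideanCLM (n := Fin d) (𝕜 := ℝ) 1 v = _
  rw [map_one]
  rfl

lemma toEuclideanLin_injective {M : Matrix (Fin d) (Fin d) ℝ} (hM : IsUnit M) :
    Function.Injective (Matrix.toEuclideanLin M) := by
  obtain ⟨N, hN⟩ := hM.exists_left_inv
  refine Function.LeftInverse.injective (g := Matrix.toEuclideanLin N) fun v => ?_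
  rw [← toEuclideanLin_mul, hN, toEuclideanLin_one]

/-- The right singular vectors of a matrix. -/
lemma exists_singular_basis (M : Matrix (Fin d) (Fin d) ℝ) :
    ∃ e : OrthonormalBasis (Fin d) ℝ (E d),
      ∀ v, ‖Matrix.toEuclideanLin M v‖ ^ 2 = ∑ k : Fin d, (sv M k * e.repr v k) ^ 2 := by
  set L := Matrix.toEuclideanLin M
  have hd : Module.finrank ℝ (E d) = d := by simp
  have hs := L.isSymmetric_adjoint_comp_self
  refine ⟨hs.eigenvectorBasis hd, fun v => ?_⟩
  have h1 : ‖L v‖ ^ 2 = inner ℝ v ((LinearMap.adjoint L ∘ₗ L) v) := by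
    rw [LinearMap.comp_apply, LinearMap.adjoint_inner_right, real_inner_self_eq_norm_sq]
  rw [h1, ← (hs.eigenvectorBasis hd).repr.inner_map_map, PiLp.inner_apply]
  refine Finset.sum_congr rfl fun k _ => ?_
  rw [hs.eigenvectorBasis_apply_self_apply hd, mul_pow, sv, L.sq_singularValues_fin hd k]
  simp
  ring

lemma sv_nonneg (M : Matrix (Fin d) (Fin d) ℝ) (k : ℕ) : 0 ≤ sv M k :=
  LinearMap.singularValues_nonneg _ k

lemma sv_antitone (M : Matrix (Fin d) (Fin d) ℝ) : Antitone (sv M) :=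
  LinearMap.singularValues_antitone _

lemma sv_pos {M : Matrix (Fin d) (Fin d) ℝ} (hM : IsUnit M) {k : ℕ} (hk : k < d) :
    0 < sv M k :=
  (LinearMap.injective_iff_forall_lt_finrank_singularValues_pos _).1
    (toEuclideanLin_injective hM) k (by simpa using hk)

lemma sv_eq_zero_of_le (M : Matrix (Fin d) (Fin d) ℝ) {k : ℕ} (hk : d ≤ k) : sv M k = 0 :=
  LinearMap.singularValues_of_finrank_le _ (by simpa using hk)

lemma sv_le_opNorm (M : Matrix (Fin d) (Fin d) ℝ) (k : ℕ) : sv M k ≤ opNorm M := by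
  rcases le_or_gt d k with hk | hk
  · rw [sv_eq_zero_of_le M hk]; exact opNorm_nonneg M
  obtain ⟨e, he⟩ := exists_singular_basis M
  have h1 := he (e ⟨k, hk⟩)
  rw [Finset.sum_eq_single ⟨k, hk⟩] at h1
  · have h2 := norm_toEuclideanLin_le M (e ⟨k, hk⟩)
    simp at h1 h2
    have h3 : sv M k = ‖Matrix.toEuclideanLin M (e ⟨k, hk⟩)‖ := by
      have := (pow_left_inj₀ (norm_nonneg _) (sv_nonneg M k) two_ne_zero).1 h1
      exact this.symm
    rw [h3]; exact h2
  · intro b _ hb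
    simp [hb]
  · simp

/-- A min-max argument: `k + 1` free coefficients against `k` linear conditions leave a nonzero
vector that `A * B` stretches by at least its `k`-th singular value, while `A` stretches its image
under `B` by at most `sv A k`. -/
lemma sv_mul_le (A B : Matrix (Fin d) (Fin d) ℝ) (k : ℕ) : sv (A * B) k ≤ sv A k * opNorm B := by
  rcases le_or_gt d k with hk | hk
  · rw [sv_eq_zero_of_le _ hk, sv_eq_zero_of_le _ hk, zero_mul]
  obtain ⟨e, he⟩ := exists_singular_basis (A * B)
  obtain ⟨f, hf⟩ := exists_singular_basis A
  -- a vector in the span of the first `k + 1` vectors of `e` whose image under `B` is orthogonal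
  -- to the first `k` vectors of `f`
  let L : (Fin (k + 1) → ℝ) →ₗ[ℝ] E d :=
    Fintype.linearCombination ℝ (fun i : Fin (k + 1) => e ⟨i, by omega⟩)
  let P : E d →ₗ[ℝ] (Fin k → ℝ) :=
    LinearMap.pi fun i => (innerₛₗ ℝ (f ⟨i, by omega⟩))
  obtain ⟨c, hc, hc0⟩ : ∃ c, (P ∘ₗ Matrix.toEuclideanLin B ∘ₗ L) c = 0 ∧ c ≠ 0 := by
    have hlt : Module.finrank ℝ (Fin k → ℝ) < Module.finrank ℝ (Fin (k + 1) → ℝ) := by simp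
    obtain ⟨c, hc, hc0⟩ := (Submodule.ne_bot_iff _).1
      (LinearMap.ker_ne_bot_of_finrank_lt (f := P ∘ₗ Matrix.toEuclideanLin B ∘ₗ L) hlt)
    exact ⟨c, hc, hc0⟩
  set u := L c with hu
  have hLI : LinearIndependent ℝ (fun i : Fin (k + 1) => e ⟨i, by omega⟩) :=
    (e.orthonormal.comp (fun i : Fin (k + 1) => (⟨i, by omega⟩ : Fin d))
      (fun i j h => by simpa [Fin.ext_iff] using h)).linearIndependent
  have hu0 : u ≠ 0 := by
    intro h0
    apply hc0
    exact funext (Fintype.linearIndependent_iff.1 hLI c h0)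
  have hrepr : ∀ i : Fin d, k < i → e.repr u i = 0 := by
    intro i hi
    rw [hu, Fintype.linearCombination_apply, map_sum]
    simp only [map_smul, e.repr_self, WithLp.ofLp_sum, Finset.sum_apply, PiLp.smul_apply]
    refine Finset.sum_eq_zero fun j _ => ?_
    have : i ≠ ⟨j, by omega⟩ := by
      intro h; have := congrArg Fin.val h; simp at this; omega
    simp [this]
  have hreprf : ∀ i : Fin d, i < k → f.repr (Matrix.toEuclideanLin B u) i = 0 := by
    intro i hi
    have := congrFun hc ⟨i, hi⟩
    rw [f.repr_apply_apply]
    exact this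
  have h1 : (sv (A * B) k * ‖u‖) ^ 2 ≤ ‖Matrix.toEuclideanLin (A * B) u‖ ^ 2 := by
    rw [he, mul_pow, ← e.repr.norm_map u, EuclideanSpace.norm_sq_eq, Finset.mul_sum]
    refine Finset.sum_le_sum fun i _ => ?_
    rw [mul_pow, Real.norm_eq_abs, sq_abs]
    rcases lt_or_ge k i with hi | hi
    · simp [hrepr i hi]
    · gcongr
      · exact sv_nonneg _ _
      · exact sv_antitone _ hi
  have h2 : ‖Matrix.toEuclideanLin (A * B) u‖ ^ 2
      ≤ (sv A k * ‖Matrix.toEuclideanLin B u‖) ^ 2 := by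
    rw [toEuclideanLin_mul, hf, mul_pow, ← f.repr.norm_map (Matrix.toEuclideanLin B u),
      EuclideanSpace.norm_sq_eq, Finset.mul_sum]
    refine Finset.sum_le_sum fun i _ => ?_
    rw [mul_pow, Real.norm_eq_abs, sq_abs]
    rcases lt_or_ge (i : ℕ) k with hi | hi
    · simp [hreprf i hi]
    · gcongr
      · exact sv_nonneg _ _
      · exact sv_antitone _ hi
  have h3 : sv (A * B) k * ‖u‖ ≤ sv A k * ‖Matrix.toEuclideanLin B u‖ :=
    le_of_sq_le_sq (h1.trans h2) (mul_nonneg (sv_nonneg _ _) (norm_nonneg _))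
  have h4 : sv (A * B) k * ‖u‖ ≤ (sv A k * opNorm B) * ‖u‖ := by
    refine h3.trans ?_
    rw [mul_assoc]
    exact mul_le_mul_of_nonneg_left (norm_toEuclideanLin_le B u) (sv_nonneg _ _)
  exact le_of_mul_le_mul_right h4 (norm_pos_iff.2 hu0)

/-- The reciprocal, up to a constant, of the number of balls of radius `r` needed to cover the image
of the unit ball under `M`. -/
def zfun (M : Matrix (Fin d) (Fin d) ℝ) (r : ℝ) : ℝ :=
  ∏ k ∈ Finset.range d, min r (sv M k) / sv M k

lemma zfun_eq {M : Matrix (Fin d) (Fin d) ℝ} (hM : IsUnit M) (r : ℝ) :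
    zfun M r = ∏ k ∈ Finset.range d, min (r / sv M k) 1 := by
  refine Finset.prod_congr rfl fun k hk => ?_
  have := sv_pos hM (Finset.mem_range.1 hk)
  rw [← min_div_div_right this.le, div_self this.ne']

lemma zfun_nonneg (M : Matrix (Fin d) (Fin d) ℝ) {r : ℝ} (hr : 0 ≤ r) : 0 ≤ zfun M r :=
  Finset.prod_nonneg fun k _ => div_nonneg (le_min hr (sv_nonneg M k)) (sv_nonneg M k)

lemma zfun_pos {M : Matrix (Fin d) (Fin d) ℝ} (hM : IsUnit M) {r : ℝ} (hr : 0 < r) :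
    0 < zfun M r := by
  rw [zfun_eq hM]
  exact Finset.prod_pos fun k hk =>
    lt_min (div_pos hr (sv_pos hM (Finset.mem_range.1 hk))) one_pos

lemma zfun_le_one (M : Matrix (Fin d) (Fin d) ℝ) {r : ℝ} (hr : 0 ≤ r) : zfun M r ≤ 1 :=
  Finset.prod_le_one (fun k _ => div_nonneg (le_min hr (sv_nonneg M k)) (sv_nonneg M k))
    fun k _ => div_le_one_of_le₀ (min_le_right _ _) (sv_nonneg M k)

lemma zfun_eq_one {M : Matrix (Fin d) (Fin d) ℝ} (hM : IsUnit M) {r : ℝ} (h : opNorm M ≤ r) :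
    zfun M r = 1 := by
  rw [zfun_eq hM]
  refine Finset.prod_eq_one fun k hk => min_eq_right ?_
  rw [one_le_div (sv_pos hM (Finset.mem_range.1 hk))]
  exact (sv_le_opNorm M k).trans h

lemma zfun_mono (M : Matrix (Fin d) (Fin d) ℝ) {r r' : ℝ} (hr : 0 ≤ r) (h : r ≤ r') :
    zfun M r ≤ zfun M r' :=
  Finset.prod_le_prod (fun k _ => div_nonneg (le_min hr (sv_nonneg M k)) (sv_nonneg M k))
    fun k _ => div_le_div_of_nonneg_right (min_le_min_right _ h) (sv_nonneg M k)

lemma zfun_two_mul_le (M : Matrix (Fin d) (Fin d) ℝ) {r : ℝ} (hr : 0 ≤ r) :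
    zfun M (2 * r) ≤ 2 ^ d * zfun M r := by
  have h : (2 : ℝ) ^ d = ∏ k ∈ Finset.range d, (2 : ℝ) := by simp
  rw [h, zfun, zfun, ← Finset.prod_mul_distrib]
  have h2 : (0 : ℝ) ≤ 2 * r := by linarith
  refine Finset.prod_le_prod
    (fun k _ => div_nonneg (le_min h2 (sv_nonneg M k)) (sv_nonneg M k)) fun k _ => ?_
  rw [← mul_div_assoc]
  refine div_le_div_of_nonneg_right ?_ (sv_nonneg M k)
  rw [mul_min_of_nonneg _ _ zero_le_two]
  exact min_le_min_left _ (by linarith [sv_nonneg M k])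

lemma pow_le_zfun {M : Matrix (Fin d) (Fin d) ℝ} (hM : IsUnit M) (h : opNorm M ≤ 1) {r : ℝ}
    (hr : 0 ≤ r) (hr1 : r ≤ 1) : r ^ d ≤ zfun M r := by
  have h' : r ^ d = ∏ k ∈ Finset.range d, r := by simp
  rw [zfun_eq hM, h']
  refine Finset.prod_le_prod (fun _ _ => hr) fun k hk => le_min ?_ hr1
  rw [le_div_iff₀ (sv_pos hM (Finset.mem_range.1 hk))]
  exact mul_le_of_le_one_right hr ((sv_le_opNorm M k).trans h)

/-- A contraction on the right lowers every singular value. Hence `zfun` grows along prefixes, which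
bounds `Z` from below on a whole cylinder. -/
lemma zfun_le_zfun_mul {A B : Matrix (Fin d) (Fin d) ℝ} (hA : IsUnit A) (hB : IsUnit B)
    (h : opNorm B ≤ 1) {r : ℝ} (hr : 0 ≤ r) : zfun A r ≤ zfun (A * B) r := by
  rw [zfun_eq hA, zfun_eq (hA.mul hB)]
  refine Finset.prod_le_prod
    (fun k _ => le_min (div_nonneg hr (sv_nonneg A k)) zero_le_one) fun k hk => ?_
  refine min_le_min_right _ (div_le_div_of_nonneg_left hr
    (sv_pos (hA.mul hB) (Finset.mem_range.1 hk)) ?_)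
  exact (sv_mul_le A B k).trans (mul_le_of_le_one_right (sv_nonneg A k) h)

/-- The exponent of the `k`-th singular value in `φ^s`. -/
def svExp (s : ℝ) (k : ℕ) : ℝ := max 0 (min 1 (s - k))

lemma svExp_nonneg (s : ℝ) (k : ℕ) : 0 ≤ svExp s k := le_max_left _ _

lemma svExp_le_one (s : ℝ) (k : ℕ) : svExp s k ≤ 1 :=
  max_le zero_le_one (min_le_left _ _)

lemma svExp_mono {s t : ℝ} (h : s ≤ t) (k : ℕ) : svExp s k ≤ svExp t k :=
  max_le_max_left _ (min_le_min_left _ (by linarith))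

lemma svExp_of_lt {s : ℝ} (hs : 0 ≤ s) {k : ℕ} (hk : k < ⌊s⌋₊) : svExp s k = 1 := by
  have h1 : ((k + 1 : ℕ) : ℝ) ≤ s := (Nat.le_floor_iff hs).1 hk
  push_cast at h1
  rw [svExp, min_eq_left (by linarith), max_eq_right zero_le_one]

lemma svExp_floor {s : ℝ} (hs : 0 ≤ s) : svExp s ⌊s⌋₊ = s - ⌊s⌋₊ := by
  have h1 := Nat.floor_le hs
  have h2 := Nat.lt_floor_add_one s
  rw [svExp, min_eq_right (by linarith), max_eq_right (by linarith)]

lemma svExp_of_gt {s : ℝ} {k : ℕ} (hk : ⌊s⌋₊ < k) : svExp s k = 0 := by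
  have h1 : s < k := Nat.lt_of_floor_lt hk
  rw [svExp, min_eq_right (by linarith), max_eq_left (by linarith)]

lemma sum_svExp {s : ℝ} (hs : 0 ≤ s) (n : ℕ) :
    ∑ k ∈ Finset.range n, svExp s k = min s n := by
  induction n with
  | zero => simp [hs]
  | succ n ih =>
    rw [Finset.sum_range_succ, ih, svExp]
    push_cast
    rcases le_total s n with h | h
    · rw [min_eq_left h, min_eq_right (by linarith), max_eq_left (by linarith),
        min_eq_left (by linarith), add_zero]
    · rw [min_eq_right h, max_eq_right (le_min zero_le_one (by linarith))]
      rcases le_total s (n + 1) with h' | h'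
      · rw [min_eq_right (by linarith), min_eq_left h']; ring
      · rw [min_eq_left (by linarith), min_eq_right h']

/-- Truncated exponents replace the case distinction at `⌊s⌋₊`, so that bounds, monotonicity and
continuity in `s` can be checked factor by factor. -/
lemma svFun_eq {s : ℝ} (hs : 0 ≤ s) (hsd : s < d) (M : Matrix (Fin d) (Fin d) ℝ) :
    svFun s M = ∏ k ∈ Finset.range d, sv M k ^ svExp s k := by
  have hk : ⌊s⌋₊ < d := (Nat.floor_lt hs).2 hsd
  obtain ⟨l, rfl⟩ : ∃ l, d = ⌊s⌋₊ + (1 + l) := ⟨d - ⌊s⌋₊ - 1, by omega⟩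
  rw [svFun, if_pos hsd, Finset.prod_range_add, Finset.prod_range_add]
  have h1 : ∏ x ∈ Finset.range l, sv M (⌊s⌋₊ + (1 + x)) ^ svExp s (⌊s⌋₊ + (1 + x)) = 1 :=
    Finset.prod_eq_one fun x _ => by rw [svExp_of_gt (by omega), Real.rpow_zero]
  rw [h1, mul_one, Finset.prod_range_one, add_zero, svExp_floor hs]
  congr 1
  refine Finset.prod_congr rfl fun k hk => ?_
  rw [svExp_of_lt hs (Finset.mem_range.1 hk), Real.rpow_one]

lemma prod_rpow_svExp {s : ℝ} (hs : 0 ≤ s) (hsd : s ≤ d) {r : ℝ} (hr : 0 < r) :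
    ∏ k ∈ Finset.range d, r ^ svExp s k = r ^ s := by
  rw [← Real.rpow_sum_of_pos hr, sum_svExp hs, min_eq_left hsd]

/-- Compare factors with exponent `e` in `[0, 1]`: if `r ≤ α`, then `r / α ≤ (r / α) ^ e`; if `α ≤
r`, then `α ^ e ≤ r ^ e`. The exponents add up to `s`. -/
lemma zfun_mul_svFun_le {M : Matrix (Fin d) (Fin d) ℝ} (hM : IsUnit M) {s : ℝ} (hs : 0 ≤ s)
    (hsd : s < d) {r : ℝ} (hr : 0 < r) : zfun M r * svFun s M ≤ r ^ s := by
  rw [svFun_eq hs hsd, zfun_eq hM, ← prod_rpow_svExp hs hsd.le hr, ← Finset.prod_mul_distrib]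
  have hα : ∀ k ∈ Finset.range d, 0 < sv M k := fun k hk => sv_pos hM (Finset.mem_range.1 hk)
  refine Finset.prod_le_prod (fun k hk => ?_) fun k hk => ?_
  · have := hα k hk
    positivity
  have hk := hα k hk
  rcases le_total r (sv M k) with h | h
  · calc min (r / sv M k) 1 * sv M k ^ svExp s k
        ≤ (r / sv M k) ^ svExp s k * sv M k ^ svExp s k := by
          gcongr
          have h1 : r / sv M k ≤ 1 := (div_le_one hk).2 h
          rw [min_eq_left h1]
          calc r / sv M k = (r / sv M k) ^ (1 : ℝ) := (Real.rpow_one _).symm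
            _ ≤ _ := Real.rpow_le_rpow_of_exponent_ge (by positivity) h1 (svExp_le_one _ _)
      _ = r ^ svExp s k := by
          rw [← Real.mul_rpow (by positivity) hk.le, div_mul_cancel₀ _ hk.ne']
  · calc min (r / sv M k) 1 * sv M k ^ svExp s k ≤ 1 * r ^ svExp s k := by
          gcongr
          · exact min_le_right _ _
          · exact svExp_nonneg _ _
      _ = _ := one_mul _

/-- At this radius no factor loses anything: larger singular values carry exponent `1`, smaller ones
exponent `0`, and the remaining one equals the radius. -/
lemma zfun_mul_svFun_eq {M : Matrix (Fin d) (Fin d) ℝ} (hM : IsUnit M) {s : ℝ} (hs : 0 ≤ s)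
    (hsd : s < d) : zfun M (sv M ⌊s⌋₊) * svFun s M = sv M ⌊s⌋₊ ^ s := by
  have hα : ∀ k ∈ Finset.range d, 0 < sv M k := fun k hk => sv_pos hM (Finset.mem_range.1 hk)
  have hr : 0 < sv M ⌊s⌋₊ := sv_pos hM ((Nat.floor_lt hs).2 hsd)
  rw [svFun_eq hs hsd, zfun_eq hM, ← prod_rpow_svExp hs hsd.le hr, ← Finset.prod_mul_distrib]
  refine Finset.prod_congr rfl fun k hk => ?_
  have hk := hα k hk
  rcases lt_trichotomy k ⌊s⌋₊ with h | h | h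
  · rw [svExp_of_lt hs h, min_eq_left ((div_le_one hk).2 (sv_antitone M h.le)), Real.rpow_one,
      Real.rpow_one, div_mul_cancel₀ _ hk.ne']
  · rw [h] at hk ⊢
    rw [div_self hk.ne', min_self, one_mul]
  · rw [svExp_of_gt h, min_eq_right ((one_le_div hk).2 (sv_antitone M h.le))]
    simp

lemma svFun_pos {M : Matrix (Fin d) (Fin d) ℝ} (hM : IsUnit M) {s : ℝ} (hs : 0 ≤ s)
    (hsd : s < d) : 0 < svFun s M := by
  rw [svFun_eq hs hsd]
  exact Finset.prod_pos fun k hk => Real.rpow_pos_of_pos (sv_pos hM (Finset.mem_range.1 hk)) _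

lemma svFun_anti {M : Matrix (Fin d) (Fin d) ℝ} (hM : IsUnit M) (h1 : opNorm M ≤ 1) {s t : ℝ}
    (hs : 0 ≤ s) (hst : s ≤ t) (htd : t < d) : svFun t M ≤ svFun s M := by
  rw [svFun_eq hs (hst.trans_lt htd), svFun_eq (hs.trans hst) htd]
  refine Finset.prod_le_prod (fun k _ => Real.rpow_nonneg (sv_nonneg M k) _) fun k hk => ?_
  exact Real.rpow_le_rpow_of_exponent_ge (sv_pos hM (Finset.mem_range.1 hk))
    ((sv_le_opNorm M k).trans h1) (svExp_mono hst k)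

lemma svFun_zero (hd : 0 < d) (M : Matrix (Fin d) (Fin d) ℝ) : svFun 0 M = 1 := by
  simp [svFun, hd]

/-- Intermediate values between `φ^0 = 1` and `φ^t`; this supplies members of the set whose infimum
is `S`. -/
lemma exists_svFun_eq {M : Matrix (Fin d) (Fin d) ℝ} (hM : IsUnit M) {t : ℝ} (ht : 0 ≤ t)
    (htd : t < d) {p : ℝ} (hp : svFun t M ≤ p) (hp1 : p ≤ 1) :
    ∃ s, 0 ≤ s ∧ s ≤ t ∧ svFun s M = p := by
  have hd : 0 < d := by exact_mod_cast ht.trans_lt htd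
  have hcont : ContinuousOn (fun s => svFun s M) (Set.Icc 0 t) := by
    have h : ContinuousOn (fun s : ℝ => ∏ k ∈ Finset.range d, sv M k ^ svExp s k)
        (Set.Icc 0 t) := by
      refine continuousOn_finsetProd _ fun k hk => Continuous.continuousOn ?_
      refine Continuous.rpow continuous_const ?_
        fun _ => Or.inl (sv_pos hM (Finset.mem_range.1 hk)).ne'
      unfold svExp
      fun_prop
    exact h.congr fun s hs => svFun_eq hs.1 (hs.2.trans_lt htd) M
  obtain ⟨s, hs, hsp⟩ := intermediate_value_Icc' ht hcont ⟨hp, by rwa [svFun_zero hd]⟩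
  exact ⟨s, hs.1, hs.2, hsp⟩

end SingularValues

/-! ### Volumes, grids and expanding maps -/

section Geometry

variable {d : ℕ}

lemma abs_repr_mul_sv_le {M : Matrix (Fin d) (Fin d) ℝ} {e : OrthonormalBasis (Fin d) ℝ (E d)}
    (he : ∀ v, ‖Matrix.toEuclideanLin M v‖ ^ 2 = ∑ k : Fin d, (sv M k * e.repr v k) ^ 2)
    (v : E d) (k : Fin d) : sv M k * |e.repr v k| ≤ ‖Matrix.toEuclideanLin M v‖ := by
  refine le_of_sq_le_sq ?_ (norm_nonneg _)
  rw [he v, mul_pow, sq_abs, ← mul_pow]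
  exact Finset.single_le_sum (f := fun k : Fin d => (sv M k * e.repr v k) ^ 2)
    (fun _ _ => sq_nonneg _) (Finset.mem_univ k)

lemma abs_repr_le (e : OrthonormalBasis (Fin d) ℝ (E d)) (v : E d) (k : Fin d) :
    |e.repr v k| ≤ ‖v‖ := by
  rw [← e.repr.norm_map v, ← Real.norm_eq_abs]
  exact PiLp.norm_apply_le _ k

/-- The volume of a set of vectors with bounded coordinates in an orthonormal basis. -/
lemma volume_box_le (e : OrthonormalBasis (Fin d) ℝ (E d)) (b : Fin d → ℝ) :
    volume {v : E d | ∀ k, |e.repr v k| ≤ b k} ≤ ENNReal.ofReal (∏ k, 2 * b k) := by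
  classical
  by_cases hb : ∀ k, 0 ≤ b k
  · have h1 : MeasurePreserving (fun v : E d => WithLp.ofLp (e.repr v)) volume volume :=
      (EuclideanSpace.volume_preserving_symm_measurableEquiv_toLp (Fin d)).comp
        e.measurePreserving_repr
    have h2 : {v : E d | ∀ k, |e.repr v k| ≤ b k}
        = (fun v : E d => WithLp.ofLp (e.repr v)) ⁻¹'
          (Set.univ.pi fun k => Set.Icc (-b k) (b k)) := by
      ext v
      simp [abs_le, Pi.le_def, forall_and]
    rw [h2, h1.measure_preimage (MeasurableSet.univ_pi fun _ => measurableSet_Icc).nullMeasurableSet,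
      volume_pi_pi, ENNReal.ofReal_prod_of_nonneg fun k _ => by linarith [hb k]]
    refine Finset.prod_le_prod' fun k _ => ?_
    rw [Real.volume_Icc]
    exact ENNReal.ofReal_le_ofReal (by linarith)
  · push Not at hb
    obtain ⟨k, hk⟩ := hb
    have h : {v : E d | ∀ k, |e.repr v k| ≤ b k} = ∅ :=
      Set.eq_empty_of_forall_notMem fun v hv => by
        have := hv k
        linarith [abs_nonneg (e.repr v k)]
    rw [h]
    simp

/-- In singular coordinates the set lies in a box with half-sides `C * min (r / α_k) 1`; the
assumption `1 ≤ C` allows `C` to be factored out of the minimum. -/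
lemma volume_norm_le {M : Matrix (Fin d) (Fin d) ℝ} (hM : IsUnit M) {C r : ℝ} (hC : 1 ≤ C)
    (hr : 0 < r) :
    volume {v : E d | ‖v‖ ≤ C ∧ ‖Matrix.toEuclideanLin M v‖ ≤ r}
      ≤ ENNReal.ofReal ((2 * C) ^ d * zfun M r) := by
  obtain ⟨e, he⟩ := exists_singular_basis M
  refine (measure_mono (t := {v : E d | ∀ k, |e.repr v k| ≤ C * min (r / sv M k) 1}) ?_).trans
    ((volume_box_le e _).trans (ENNReal.ofReal_le_ofReal (le_of_eq ?_)))
  · rintro v ⟨h1, h2⟩ k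
    have hk := sv_pos hM k.2
    rw [mul_min_of_nonneg _ _ (by linarith), mul_one]
    refine le_min ?_ ((abs_repr_le e v k).trans h1)
    have h3 : |e.repr v k| ≤ r / sv M k := by
      rw [le_div_iff₀' hk]
      exact (abs_repr_mul_sv_le he v k).trans h2
    exact h3.trans (le_mul_of_one_le_left (by positivity) hC)
  · rw [zfun_eq hM, ← Fin.prod_univ_eq_prod_range (fun k => min (r / sv M k) 1) d]
    simp_rw [← mul_assoc]
    rw [Finset.prod_mul_distrib]
    simp

/-- The ball of radius `R` can be divided into about `1 / zfun M r` cells with images of diameter at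
most `r` under `M`. -/
lemma exists_cells {M : Matrix (Fin d) (Fin d) ℝ} (hM : IsUnit M) {R r : ℝ} (hR : 0 ≤ R)
    (hr : 0 < r) :
    ∃ (q : E d → Fin d → ℤ) (F : Finset (Fin d → ℤ)),
      (∀ u, ‖u‖ ≤ R → q u ∈ F) ∧
      (∀ u u', q u = q u' →
        ‖Matrix.toEuclideanLin M u - Matrix.toEuclideanLin M u'‖ ≤ r) ∧
      F.card * zfun M r ≤ (2 * R * d + 3) ^ d := by
  obtain ⟨e, he⟩ := exists_singular_basis M
  have hα : ∀ k : Fin d, 0 < sv M k := fun k => sv_pos hM k.2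
  have hd0 : ∀ k : Fin d, (0 : ℝ) < d := fun k => by exact_mod_cast k.pos
  -- `M` stretches the `k`-th side of a grid cell to `r / d`, so the `d` coordinates together
  -- contribute at most `r`.
  let δ : Fin d → ℝ := fun k => r / (sv M k * d)
  have hδ : ∀ k, 0 < δ k := fun k => div_pos hr (mul_pos (hα k) (hd0 k))
  let N : Fin d → ℕ := fun k => ⌈R / δ k⌉₊
  refine ⟨fun u k => ⌊e.repr u k / δ k⌋, Fintype.piFinset fun k => Finset.Icc (-(N k : ℤ)) (N k),
    fun u hu => ?_, fun u u' huu' => ?_, ?_⟩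
  · rw [Fintype.mem_piFinset]
    intro k
    have h1 : |e.repr u k / δ k| ≤ N k := by
      rw [abs_div, abs_of_pos (hδ k)]
      refine le_trans ?_ (Nat.le_ceil _)
      gcongr
      · exact (hδ k).le
      · exact (abs_repr_le e u k).trans hu
    obtain ⟨h2, h3⟩ := abs_le.1 h1
    rw [Finset.mem_Icc]
    constructor
    · rw [Int.le_floor]; push_cast; exact h2
    · have := (Int.floor_le (e.repr u k / δ k)).trans h3
      change ⌊e.repr u k / δ k⌋ ≤ (N k : ℤ)
      refine Int.cast_le (R := ℝ).1 ?_
      rw [Int.cast_natCast]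
      exact this
  · rw [← map_sub]
    refine le_of_sq_le_sq ?_ hr.le
    rw [he]
    have h1 : ∀ k : Fin d, (sv M k * e.repr (u - u') k) ^ 2 ≤ (r / d) ^ 2 := by
      intro k
      have h2 : |e.repr u k / δ k - e.repr u' k / δ k| < 1 :=
        Int.abs_sub_lt_one_of_floor_eq_floor (congrFun huu' k)
      have h3 : |e.repr (u - u') k| < δ k := by
        rw [← sub_div, abs_div, abs_of_pos (hδ k), div_lt_one (hδ k)] at h2
        simpa using h2
      rw [← sq_abs, abs_mul, abs_of_pos (hα k)]
      have h4 : sv M k * δ k = r / d := by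
        have := hd0 k
        have := hα k
        simp only [δ]
        field_simp
      rw [← h4]
      have := hα k
      gcongr
    refine (Finset.sum_le_sum fun k _ => h1 k).trans ?_
    rw [Finset.sum_const, Finset.card_univ, Fintype.card_fin, nsmul_eq_mul]
    rcases Nat.eq_zero_or_pos d with rfl | hd
    · simp; positivity
    · have h5 : (1 : ℝ) ≤ d := by exact_mod_cast hd
      have h6 : (d : ℝ) * (r / d) ^ 2 = r ^ 2 / d := by field_simp
      rw [h6]
      exact div_le_self (by positivity) h5
  · rw [Fintype.card_piFinset, zfun_eq hM,
      ← Fin.prod_univ_eq_prod_range (fun k => min (r / sv M k) 1) d, Nat.cast_prod,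
      ← Finset.prod_mul_distrib]
    have h1 : ((2 * R * d + 3) ^ d : ℝ) = ∏ _k : Fin d, (2 * R * d + 3) := by simp
    rw [h1]
    refine Finset.prod_le_prod (fun k _ => ?_) fun k _ => ?_
    · have := hα k
      positivity
    have hk := hα k
    have hd := hd0 k
    have h2 : ((Finset.Icc (-(N k : ℤ)) (N k)).card : ℝ) = 2 * N k + 1 := by
      rw [Int.card_Icc]
      have : ((N k : ℤ) + 1 - -(N k : ℤ)).toNat = 2 * N k + 1 := by omega
      rw [this]; push_cast; ring
    have h3 : (N k : ℝ) ≤ R / δ k + 1 := (Nat.ceil_lt_add_one (div_nonneg hR (hδ k).le)).le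
    have h4 : R / δ k = R * d * (sv M k / r) := by
      simp only [δ]
      field_simp
    rw [h2]
    rw [h4] at h3
    have hm0 : 0 ≤ min (r / sv M k) 1 := le_min (by positivity) zero_le_one
    have hm1 : min (r / sv M k) 1 ≤ 1 := min_le_right _ _
    have hm2 : sv M k / r * min (r / sv M k) 1 ≤ 1 := by
      calc sv M k / r * min (r / sv M k) 1 ≤ sv M k / r * (r / sv M k) := by
            gcongr; exact min_le_left _ _
        _ = 1 := by field_simp
    calc (2 * (N k : ℝ) + 1) * min (r / sv M k) 1
        ≤ (2 * (R * d * (sv M k / r) + 1) + 1) * min (r / sv M k) 1 := by gcongr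
      _ = 2 * R * d * (sv M k / r * min (r / sv M k) 1) + 3 * min (r / sv M k) 1 := by ring
      _ ≤ 2 * R * d * 1 + 3 * 1 := by gcongr
      _ = _ := by ring

/-- The preimage of a set under a map that expands distances up to a constant. -/
lemma exists_volume_preimage_le (d : ℕ) {c : ℝ} (hc : 0 < c) :
    ∃ K : ℝ≥0∞, K ≠ ∞ ∧ ∀ (g : E d → E d), (∀ v w, c * ‖v - w‖ ≤ ‖g v - g w‖) →
      ∀ s, volume (g ⁻¹' s) ≤ K * volume s := by
  -- Volume is a multiple of Hausdorff measure, and preimages under antilipschitz maps are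
  -- controlled for the latter without any differentiability.
  obtain ⟨κ, hκ0, hκ1, hκ⟩ : ∃ κ : ℝ≥0∞, κ ≠ 0 ∧ κ ≠ ∞ ∧
      ∀ s : Set (E d), volume s = κ * Measure.hausdorffMeasure d s := by
    have : (Measure.hausdorffMeasure (X := E d) d).IsAddHaarMeasure := by
      simpa using isAddHaarMeasure_hausdorffMeasure (E := E d)
    have h := Measure.isAddLeftInvariant_eq_smul (volume : Measure (E d))
      (Measure.hausdorffMeasure (X := E d) d)
    refine ⟨(volume : Measure (E d)).addHaarScalarFactor (Measure.hausdorffMeasure d), ?_,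
      ENNReal.coe_ne_top, fun s => ?_⟩
    · have := Measure.addHaarScalarFactor_pos_of_isAddHaarMeasure (volume : Measure (E d))
        (Measure.hausdorffMeasure (X := E d) d)
      exact_mod_cast this.ne'
    · conv_lhs => rw [h]
      rfl
  refine ⟨((Real.toNNReal c⁻¹ : NNReal) : ℝ≥0∞) ^ (d : ℝ),
    ENNReal.rpow_ne_top_of_nonneg (by positivity) ENNReal.coe_ne_top, fun g hg s => ?_⟩
  have ha : AntilipschitzWith (Real.toNNReal c⁻¹) g := by
    refine AntilipschitzWith.of_le_mul_dist fun v w => ?_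
    rw [dist_eq_norm, dist_eq_norm, Real.coe_toNNReal _ (inv_nonneg.2 hc.le), inv_mul_eq_div,
      le_div_iff₀' hc]
    exact hg v w
  rw [hκ, hκ, mul_left_comm]
  gcongr
  exact ha.hausdorffMeasure_preimage_le (by positivity) s

end Geometry

/-! ### The coding map and its transversality in the translations -/

section Coding

variable {d m : ℕ} {T : Fin m → Matrix (Fin d) (Fin d) ℝ} {ρ : ℝ}

lemma exists_contraction_ratio (h : ∀ i, opNorm (T i) < 1 / 2) :
    ∃ ρ : ℝ, 0 ≤ ρ ∧ ρ < 1 / 2 ∧ ∀ i, opNorm (T i) ≤ ρ := by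
  rcases isEmpty_or_nonempty (Fin m) with hm | hm
  · exact ⟨0, le_rfl, by norm_num, fun i => hm.elim i⟩
  · obtain ⟨i, hi⟩ := Finite.exists_max fun i => opNorm (T i)
    exact ⟨opNorm (T i), opNorm_nonneg _, h i, hi⟩

lemma isUnit_wordMat (hT : ∀ i, IsUnit (T i)) (x : Shift m) (n : ℕ) : IsUnit (wordMat T x n) := by
  induction n with
  | zero => exact isUnit_one
  | succ n ih => exact ih.mul (hT _)

lemma opNorm_wordMat_le (hρ0 : 0 ≤ ρ) (hρ : ∀ i, opNorm (T i) ≤ ρ) (x : Shift m) (n : ℕ) :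
    opNorm (wordMat T x n) ≤ ρ ^ n := by
  induction n with
  | zero => exact opNorm_one_le
  | succ n ih =>
    rw [wordMat, pow_succ]
    exact (opNorm_mul_le _ _).trans (mul_le_mul ih (hρ _) (opNorm_nonneg _) (pow_nonneg hρ0 n))

lemma wordMat_congr {x y : Shift m} {n : ℕ} (h : ∀ i < n, x i = y i) :
    wordMat T x n = wordMat T y n := by
  induction n with
  | zero => rfl
  | succ n ih => rw [wordMat, wordMat, ih fun i hi => h i (by omega), h n (by omega)]

lemma wordMat_add (x : Shift m) (j k : ℕ) :
    wordMat T x (j + k) = wordMat T x j * wordMat T (fun i => x (j + i)) k := by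
  induction k with
  | zero => simp [wordMat]
  | succ k ih => rw [← add_assoc, wordMat, wordMat, ih, mul_assoc]

/-- The `k`-th term of the series for the coding map. -/
def codingTerm (T : Fin m → Matrix (Fin d) (Fin d) ℝ) (a : Fin m → E d) (x : Shift m) (k : ℕ) :
    E d :=
  Matrix.toEuclideanLin (wordMat T x k) (a (x k))

lemma wordMap_eq (a : Fin m → E d) (x : Shift m) (n : ℕ) (v : E d) :
    wordMap T a x n v
      = ∑ k ∈ Finset.range n, codingTerm T a x k + Matrix.toEuclideanLin (wordMat T x n) v := by
  induction n generalizing v with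
  | zero => simp [wordMap, wordMat]
  | succ n ih =>
    rw [wordMap, Function.comp_apply, ih, affMap, map_add, Finset.sum_range_succ, wordMat,
      toEuclideanLin_mul, codingTerm]
    abel

lemma norm_codingTerm_le (hρ0 : 0 ≤ ρ) (hρ : ∀ i, opNorm (T i) ≤ ρ) (a : Fin m → E d)
    (x : Shift m) (k : ℕ) : ‖codingTerm T a x k‖ ≤ ρ ^ k * ‖a (x k)‖ :=
  (norm_toEuclideanLin_le _ _).trans
    (mul_le_mul_of_nonneg_right (opNorm_wordMat_le hρ0 hρ x k) (norm_nonneg _))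

lemma summable_norm_codingTerm (hρ0 : 0 ≤ ρ) (hρ1 : ρ < 1 / 2) (hρ : ∀ i, opNorm (T i) ≤ ρ)
    (a : Fin m → E d) (x : Shift m) : Summable fun k => ‖codingTerm T a x k‖ := by
  refine Summable.of_nonneg_of_le (fun _ => norm_nonneg _)
    (fun k => (norm_codingTerm_le hρ0 hρ a x k).trans
      (mul_le_mul_of_nonneg_left (norm_le_pi_norm a (x k)) (pow_nonneg hρ0 k)))
    ((summable_geometric_of_lt_one hρ0 (by linarith)).mul_right ‖a‖)

lemma summable_codingTerm (hρ0 : 0 ≤ ρ) (hρ1 : ρ < 1 / 2) (hρ : ∀ i, opNorm (T i) ≤ ρ)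
    (a : Fin m → E d) (x : Shift m) : Summable fun k => codingTerm T a x k :=
  (summable_norm_codingTerm hρ0 hρ1 hρ a x).of_norm

lemma coding_eq (hρ0 : 0 ≤ ρ) (hρ1 : ρ < 1 / 2) (hρ : ∀ i, opNorm (T i) ≤ ρ)
    (a : Fin m → E d) (x : Shift m) : coding T a x = ∑' k, codingTerm T a x k := by
  refine Tendsto.limUnder_eq ?_
  simp only [wordMap_eq, map_zero, add_zero]
  exact (summable_codingTerm hρ0 hρ1 hρ a x).hasSum.tendsto_sum_nat

lemma norm_coding_le (hρ0 : 0 ≤ ρ) (hρ1 : ρ < 1 / 2) (hρ : ∀ i, opNorm (T i) ≤ ρ)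
    {a : Fin m → E d} {R : ℝ} (ha : ∀ i, ‖a i‖ ≤ R) (x : Shift m) :
    ‖coding T a x‖ ≤ 2 * R := by
  have hR : 0 ≤ R := (norm_nonneg _).trans (ha (x 0))
  rw [coding_eq hρ0 hρ1 hρ]
  have hs := (hasSum_geometric_of_lt_one hρ0 (by linarith : ρ < 1)).mul_right R
  refine (tsum_of_norm_bounded hs fun k => (norm_codingTerm_le hρ0 hρ a x k).trans
    (mul_le_mul_of_nonneg_left (ha _) (pow_nonneg hρ0 k))).trans ?_
  refine mul_le_mul_of_nonneg_right ?_ hR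
  rw [inv_le_comm₀ (by linarith) two_pos]
  linarith

lemma coding_sub (hρ0 : 0 ≤ ρ) (hρ1 : ρ < 1 / 2) (hρ : ∀ i, opNorm (T i) ≤ ρ)
    (a b : Fin m → E d) (x : Shift m) :
    coding T (a - b) x = coding T a x - coding T b x := by
  rw [coding_eq hρ0 hρ1 hρ, coding_eq hρ0 hρ1 hρ, coding_eq hρ0 hρ1 hρ,
    ← (summable_codingTerm hρ0 hρ1 hρ a x).tsum_sub (summable_codingTerm hρ0 hρ1 hρ b x)]
  simp [codingTerm]

lemma coding_eq_add (hρ0 : 0 ≤ ρ) (hρ1 : ρ < 1 / 2) (hρ : ∀ i, opNorm (T i) ≤ ρ)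
    (a : Fin m → E d) (x : Shift m) (n : ℕ) :
    coding T a x = ∑ k ∈ Finset.range n, codingTerm T a x k +
      Matrix.toEuclideanLin (wordMat T x n) (coding T a fun i => x (n + i)) := by
  rw [coding_eq hρ0 hρ1 hρ, coding_eq hρ0 hρ1 hρ,
    ← (summable_codingTerm hρ0 hρ1 hρ a x).sum_add_tsum_nat_add n]
  congr 1
  have h := (Matrix.toEuclideanCLM (n := Fin d) (𝕜 := ℝ) (wordMat T x n)).map_tsum
    (summable_codingTerm hρ0 hρ1 hρ a fun i => x (n + i))
  refine Eq.trans ?_ h.symm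
  refine tsum_congr fun k => ?_
  rw [codingTerm, add_comm k n, wordMat_add, toEuclideanLin_mul]
  rfl

lemma coding_sub_coding (hρ0 : 0 ≤ ρ) (hρ1 : ρ < 1 / 2) (hρ : ∀ i, opNorm (T i) ≤ ρ)
    (a : Fin m → E d) {x y : Shift m} {n : ℕ} (h : ∀ i < n, x i = y i) :
    coding T a x - coding T a y = Matrix.toEuclideanLin (wordMat T x n)
      ((coding T a fun i => x (n + i)) - coding T a fun i => y (n + i)) := by
  rw [coding_eq_add hρ0 hρ1 hρ a x n, coding_eq_add hρ0 hρ1 hρ a y n, map_sub,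
    ← wordMat_congr h]
  have : ∑ k ∈ Finset.range n, codingTerm T a x k = ∑ k ∈ Finset.range n, codingTerm T a y k := by
    refine Finset.sum_congr rfl fun k hk => ?_
    have hk := Finset.mem_range.1 hk
    rw [codingTerm, codingTerm, h k hk, wordMat_congr fun i hi => h i (hi.trans hk)]
  rw [this]
  abel

lemma isLocallyConstant_of_cylinder {α : Type*} {f : Shift m → α} (n : ℕ)
    (h : ∀ x y : Shift m, (∀ i < n, x i = y i) → f x = f y) : IsLocallyConstant f := by
  rw [IsLocallyConstant.iff_exists_open]
  intro x
  exact ⟨PiNat.cylinder x n, PiNat.isOpen_cylinder (fun _ => Fin m) x n,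
    PiNat.self_mem_cylinder x n, fun y hy => h y x fun i hi => hy i hi⟩

/-- The term depends on `x` only through its first `k + 1` letters, so locally in `x` it is one
fixed linear map of `a`. -/
lemma continuous_codingTerm (T : Fin m → Matrix (Fin d) (Fin d) ℝ) (k : ℕ) :
    Continuous fun p : (Fin m → E d) × Shift m => codingTerm T p.1 p.2 k := by
  rw [continuous_iff_continuousAt]
  rintro ⟨a, x⟩
  have h : (fun p : (Fin m → E d) × Shift m => codingTerm T p.1 p.2 k) =ᶠ[𝓝 (a, x)]
      fun p => Matrix.toEuclideanCLM (n := Fin d) (𝕜 := ℝ) (wordMat T x k) (p.1 (x k)) := by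
    have h1 : ∀ᶠ p : (Fin m → E d) × Shift m in 𝓝 (a, x), p.2 ∈ PiNat.cylinder x (k + 1) :=
      continuous_snd.continuousAt.eventually
        ((PiNat.isOpen_cylinder (fun _ => Fin m) x (k + 1)).mem_nhds
          (PiNat.self_mem_cylinder x (k + 1)))
    filter_upwards [h1] with p hp
    rw [codingTerm, hp k (by omega), wordMat_congr (y := x) fun i hi => hp i (by omega)]
    rfl
  refine ContinuousAt.congr ?_ h.symm
  fun_prop

lemma measurable_coding (hρ0 : 0 ≤ ρ) (hρ1 : ρ < 1 / 2) (hρ : ∀ i, opNorm (T i) ≤ ρ) :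
    Measurable fun p : (Fin m → E d) × Shift m => coding T p.1 p.2 := by
  refine measurable_of_tendsto_metrizable
    (f := fun n (p : (Fin m → E d) × Shift m) => ∑ k ∈ Finset.range n, codingTerm T p.1 p.2 k)
    (fun n => Continuous.measurable (continuous_finsetSum _ fun k _ => continuous_codingTerm T k))
    (tendsto_pi_nhds.2 fun p => ?_)
  rw [coding_eq hρ0 hρ1 hρ]
  exact (summable_codingTerm hρ0 hρ1 hρ p.1 p.2).hasSum.tendsto_sum_nat

/-- The sum of the norms of the perturbations which the letters `i` after the first one cause in
`coding T (Pi.single i u) x - coding T (Pi.single i u) y`. -/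
def tailWeight (ρ : ℝ) (x y : Shift m) (i : Fin m) (k : ℕ) : ℝ :=
  ρ ^ (k + 1) * ((if x (k + 1) = i then 1 else 0) + (if y (k + 1) = i then 1 else 0))

lemma summable_tailWeight (hρ0 : 0 ≤ ρ) (hρ1 : ρ < 1 / 2) (x y : Shift m) (i : Fin m) :
    Summable (tailWeight ρ x y i) := by
  refine Summable.of_nonneg_of_le (fun k => ?_) (fun k => ?_)
    (((summable_nat_add_iff 1).2 (summable_geometric_of_lt_one hρ0 (by linarith))).mul_right 2)
  · unfold tailWeight
    positivity
  · unfold tailWeight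
    refine mul_le_mul_of_nonneg_left ?_ (by positivity)
    split_ifs <;> norm_num

/-- At position `0` only `x` has the letter `i`, which contributes `u` itself; all later occurrences
in `x` and `y` together contribute at most `b * ‖u‖`. -/
lemma le_norm_coding_single_of_tailWeight_le (hρ0 : 0 ≤ ρ) (hρ1 : ρ < 1 / 2)
    (hρ : ∀ i, opNorm (T i) ≤ ρ) {x y : Shift m} {i : Fin m} (hx : x 0 = i) (hy : y 0 ≠ i)
    {b : ℝ} (h : ∑' k, tailWeight ρ x y i k ≤ b) (u : E d) :
    (1 - b) * ‖u‖ ≤ ‖coding T (Pi.single i u) x - coding T (Pi.single i u) y‖ := by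
  have hsx := summable_codingTerm hρ0 hρ1 hρ (Pi.single i u) x
  have hsy := summable_codingTerm hρ0 hρ1 hρ (Pi.single i u) y
  have hx0 : codingTerm T (Pi.single i u) x 0 = u := by
    rw [codingTerm, hx, wordMat, toEuclideanLin_one, Pi.single_eq_same]
  have hy0 : codingTerm T (Pi.single i u) y 0 = 0 := by
    rw [codingTerm, Pi.single_eq_of_ne hy, map_zero]
  have hterm : ∀ (z : Shift m) (k : ℕ), ‖codingTerm T (Pi.single i u) z (k + 1)‖
      ≤ ρ ^ (k + 1) * (if z (k + 1) = i then 1 else 0) * ‖u‖ := by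
    intro z k
    refine (norm_codingTerm_le hρ0 hρ _ z (k + 1)).trans ?_
    rw [mul_assoc]
    refine mul_le_mul_of_nonneg_left ?_ (by positivity)
    split_ifs with hz
    · rw [hz, Pi.single_eq_same, one_mul]
    · rw [Pi.single_eq_of_ne hz, norm_zero, zero_mul]
  rw [coding_eq hρ0 hρ1 hρ, coding_eq hρ0 hρ1 hρ, hsx.tsum_eq_zero_add, hsy.tsum_eq_zero_add,
    hx0, hy0, zero_add, add_sub_assoc,
    ← ((summable_nat_add_iff 1).2 hsx).tsum_sub ((summable_nat_add_iff 1).2 hsy)]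
  have hb : ‖∑' k, (codingTerm T (Pi.single i u) x (k + 1)
      - codingTerm T (Pi.single i u) y (k + 1))‖ ≤ b * ‖u‖ := by
    refine (tsum_of_norm_bounded ((summable_tailWeight hρ0 hρ1 x y i).hasSum.mul_right ‖u‖)
      fun k => ?_).trans (mul_le_mul_of_nonneg_right h (norm_nonneg _))
    refine (norm_sub_le _ _).trans ((add_le_add (hterm x k) (hterm y k)).trans (le_of_eq ?_))
    rw [tailWeight]
    ring
  have := norm_sub_le_norm_add u (∑' k, (codingTerm T (Pi.single i u) x (k + 1)
      - codingTerm T (Pi.single i u) y (k + 1)))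
  linarith

/-- Pigeonhole: at each later position a sequence shows at most one of the two distinct letters `x
0` and `y 0`. Their tail weights therefore add up to at most `2 * ρ / (1 - ρ)`, and one of them is
at most half of that. -/
lemma exists_le_norm_coding_single (hρ0 : 0 ≤ ρ) (hρ1 : ρ < 1 / 2)
    (hρ : ∀ i, opNorm (T i) ≤ ρ) {x y : Shift m} (hxy : x 0 ≠ y 0) :
    ∃ i, ∀ u : E d, (1 - ρ / (1 - ρ)) * ‖u‖
      ≤ ‖coding T (Pi.single i u) x - coding T (Pi.single i u) y‖ := by
  have hsum : ∑' k, tailWeight ρ x y (x 0) k + ∑' k, tailWeight ρ x y (y 0) k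
      ≤ ρ / (1 - ρ) + ρ / (1 - ρ) := by
    have hg : HasSum (fun k : ℕ => ρ ^ (k + 1) * 2) (ρ / (1 - ρ) + ρ / (1 - ρ)) := by
      have := ((hasSum_geometric_of_lt_one hρ0 (by linarith : ρ < 1)).mul_left ρ).mul_right 2
      convert! this using 1
      · funext k; ring
      · rw [div_eq_mul_inv]; ring
    rw [← (summable_tailWeight hρ0 hρ1 x y _).tsum_add (summable_tailWeight hρ0 hρ1 x y _),
      ← hg.tsum_eq]
    refine Summable.tsum_le_tsum (fun k => ?_)
      ((summable_tailWeight hρ0 hρ1 x y _).add (summable_tailWeight hρ0 hρ1 x y _)) hg.summable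
    rw [tailWeight, tailWeight, ← mul_add]
    refine mul_le_mul_of_nonneg_left ?_ (by positivity)
    have h1 : ∀ z : Shift m, (if z (k + 1) = x 0 then (1 : ℝ) else 0)
        + (if z (k + 1) = y 0 then 1 else 0) ≤ 1 := by
      intro z
      split_ifs with h h'
      · exact absurd (h.symm.trans h') hxy
      all_goals norm_num
    linarith [h1 x, h1 y]
  rcases le_or_gt (∑' k, tailWeight ρ x y (x 0) k) (ρ / (1 - ρ)) with h | h
  · exact ⟨x 0, le_norm_coding_single_of_tailWeight_le hρ0 hρ1 hρ rfl hxy.symm h⟩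
  · refine ⟨y 0, fun u => ?_⟩
    rw [norm_sub_rev]
    refine le_norm_coding_single_of_tailWeight_le hρ0 hρ1 hρ rfl hxy ?_ u
    have hc : tailWeight ρ y x (y 0) = tailWeight ρ x y (y 0) := by
      funext k
      rw [tailWeight, tailWeight, add_comm]
      ring
    rw [hc]
    linarith

/-- The translation vectors with entries of norm at most `R`. -/
def paramBox (d m : ℕ) (R : ℝ) : Set (Fin m → E d) := {a | ∀ i, ‖a i‖ ≤ R}

lemma paramBox_eq (R : ℝ) :
    paramBox d m R = Set.univ.pi fun _ => Metric.closedBall (0 : E d) R := by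
  ext a
  simp [paramBox]

lemma measurableSet_paramBox (R : ℝ) : MeasurableSet (paramBox d m R) := by
  rw [paramBox_eq]
  exact MeasurableSet.univ_pi fun _ => measurableSet_closedBall

lemma volume_paramBox_ne_top (R : ℝ) : volume (paramBox d m R) ≠ ∞ := by
  rw [paramBox_eq, volume_pi_pi]
  exact ENNReal.prod_ne_top fun _ _ => measure_closedBall_lt_top.ne

/-- Transversality of the coding map. -/
lemma exists_volume_coding_sub_le (hT : ∀ i, IsUnit (T i)) (hρ0 : 0 ≤ ρ) (hρ1 : ρ < 1 / 2)
    (hρ : ∀ i, opNorm (T i) ≤ ρ) {R : ℝ} (hR : 1 ≤ R) :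
    ∃ C : ℝ≥0∞, C ≠ ∞ ∧ ∀ (x y : Shift m) (n : ℕ), (∀ i < n, x i = y i) → x n ≠ y n →
      ∀ r, 0 < r → volume ({a | ‖coding T a x - coding T a y‖ ≤ r} ∩ paramBox d m R)
        ≤ C * ENNReal.ofReal (zfun (wordMat T x n) r) := by
  rcases m with _ | m
  · exact ⟨0, ENNReal.zero_ne_top, fun x => (x 0).elim0⟩
  -- Here the bound `ρ < 1 / 2` is decisive.
  have hc : 0 < 1 - ρ / (1 - ρ) := by
    rw [sub_pos, div_lt_one (by linarith)]
    linarith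
  obtain ⟨K, hK, hvol⟩ := exists_volume_preimage_le d hc
  refine ⟨K * ENNReal.ofReal ((2 * (4 * R)) ^ d) * volume (paramBox d m R),
    ENNReal.mul_ne_top (ENNReal.mul_ne_top hK ENNReal.ofReal_ne_top) (volume_paramBox_ne_top R),
    fun x y n hxy hn r hr => ?_⟩
  obtain ⟨i, hi⟩ := exists_le_norm_coding_single (x := fun i => x (n + i))
    (y := fun i => y (n + i)) hρ0 hρ1 hρ hn
  set S := {a | ‖coding T a x - coding T a y‖ ≤ r} ∩ paramBox d (m + 1) R with hS
  have hSm : MeasurableSet S := by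
    refine MeasurableSet.inter (measurableSet_le ?_ measurable_const) (measurableSet_paramBox R)
    have h1 := fun z : Shift (m + 1) =>
      (measurable_coding hρ0 hρ1 hρ).comp (measurable_prodMk_right (y := z))
    exact ((h1 x).sub (h1 y)).norm
  have hmp := (volume_preserving_piFinSuccAbove (fun _ : Fin (m + 1) => E d) i).symm
  rw [← hmp.measure_preimage_equiv, Measure.volume_eq_prod,
    Measure.prod_apply_symm (hSm.preimage (MeasurableEquiv.measurable _))]
  have hslice : ∀ w : Fin m → E d,
      volume ((fun v : E d => (v, w)) ⁻¹'
        ((MeasurableEquiv.piFinSuccAbove (fun _ : Fin (m + 1) => E d) i).symm ⁻¹' S))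
      ≤ (paramBox d m R).indicator (fun _ => K * ENNReal.ofReal ((2 * (4 * R)) ^ d)
          * ENNReal.ofReal (zfun (wordMat T x n) r)) w := by
    intro w
    by_cases hw : w ∈ paramBox d m R
    · rw [Set.indicator_of_mem hw]
      -- All translations but the `i`-th are frozen. Since the coding map is additive in `a`, a
      -- change of `v` acts through `Pi.single i`, so `g` expands distances.
      let g : E d → E d := fun v => (coding T (i.insertNth v w) fun i => x (n + i))
        - coding T (i.insertNth v w) fun i => y (n + i)
      have hg : ∀ v v', (1 - ρ / (1 - ρ)) * ‖v - v'‖ ≤ ‖g v - g v'‖ := by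
        intro v v'
        have h2 : (i.insertNth v w : Fin (m + 1) → E d) - i.insertNth v' w
            = Pi.single i (v - v') := by
          rw [← Fin.insertNth_sub, sub_self, Fin.insertNth_zero_right]
        refine (hi (v - v')).trans (le_of_eq ?_)
        rw [← h2, coding_sub hρ0 hρ1 hρ, coding_sub hρ0 hρ1 hρ]
        congr 1
        simp only [g]
        abel
      -- The radius `4 * R` comes from two coded points of norm at most `2 * R` each.
      refine (measure_mono (t := g ⁻¹' {v | ‖v‖ ≤ 4 * R ∧
        ‖Matrix.toEuclideanLin (wordMat T x n) v‖ ≤ r}) ?_).trans ((hvol g hg _).trans ?_)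
      · intro v hv
        have hv1 : ‖coding T (i.insertNth v w) x - coding T (i.insertNth v w) y‖ ≤ r := hv.1
        have hv2 : ∀ k, ‖(i.insertNth v w : Fin (m + 1) → E d) k‖ ≤ R := hv.2
        rw [coding_sub_coding hρ0 hρ1 hρ _ hxy] at hv1
        refine ⟨?_, hv1⟩
        refine (norm_sub_le _ _).trans ?_
        have h3 := norm_coding_le hρ0 hρ1 hρ hv2 fun i => x (n + i)
        have h4 := norm_coding_le hρ0 hρ1 hρ hv2 fun i => y (n + i)
        linarith
      · rw [mul_assoc]
        gcongr
        rw [← ENNReal.ofReal_mul (by positivity)]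
        exact volume_norm_le (isUnit_wordMat hT x n) (by linarith) hr
    · rw [Set.indicator_of_notMem hw, nonpos_iff_eq_zero]
      have hempty : (fun v : E d => (v, w)) ⁻¹'
          ((MeasurableEquiv.piFinSuccAbove (fun _ : Fin (m + 1) => E d) i).symm ⁻¹' S) = ∅ := by
        refine Set.eq_empty_of_forall_notMem fun v hv => hw fun k => ?_
        have hv2 : ∀ k, ‖(i.insertNth v w : Fin (m + 1) → E d) k‖ ≤ R := hv.2
        simpa using hv2 (i.succAbove k)
      rw [hempty, measure_empty]
  refine (lintegral_mono hslice).trans ?_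
  rw [lintegral_indicator_const (measurableSet_paramBox R)]
  exact le_of_eq (by ring)

end Coding

/-! ### A Borel–Cantelli lemma in two variables -/

section BorelCantelli

lemma lintegral_measure_swap {α β : Type*} [MeasurableSpace α] [MeasurableSpace β]
    (ν : Measure α) (μ : Measure β) [SFinite ν] [SFinite μ] {s : Set (α × β)}
    (hs : MeasurableSet s) :
    ∫⁻ a, μ {b | (a, b) ∈ s} ∂ν = ∫⁻ b, ν {a | (a, b) ∈ s} ∂μ :=
  (Measure.prod_apply hs).symm.trans (Measure.prod_apply_symm hs)

lemma tsum_inv_sq_ne_top : ∑' n : ℕ, (((n : ℝ≥0∞) + 1) ^ 2)⁻¹ ≠ ∞ := by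
  have h : Summable fun n : ℕ => (((n : ℝ) + 1) ^ 2)⁻¹ := by
    have := (summable_nat_add_iff 1).2 (Real.summable_nat_pow_inv.2 one_lt_two)
    simpa using this
  have h2 := h.tsum_ofReal_ne_top
  convert h2 using 4 with n
  rw [ENNReal.ofReal_inv_of_pos (by positivity), ENNReal.ofReal_pow (by positivity),
    ENNReal.ofReal_add (by positivity) zero_le_one, ENNReal.ofReal_natCast, ENNReal.ofReal_one]

/-- A Borel--Cantelli argument for functions of two variables. -/
lemma ae_ae_eventually_le_of_lintegral_le {α β : Type*} [MeasurableSpace α] [MeasurableSpace β]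
    {ν : Measure α} {μ : Measure β} [SFinite ν] [IsFiniteMeasure μ] {f : ℕ → α × β → ℝ≥0∞}
    {g : ℕ → β → ℝ≥0∞} (hf : ∀ n, Measurable (f n)) (hg : ∀ n, Measurable (g n))
    (hg0 : ∀ n x, g n x ≠ 0) (hg1 : ∀ n x, g n x ≠ ∞) {C : ℝ≥0∞} (hC : C ≠ ∞)
    (hfg : ∀ n x, ∫⁻ a, f n (a, x) ∂ν ≤ C * g n x) :
    ∀ᵐ a ∂ν, ∀ᵐ x ∂μ, ∀ᶠ n : ℕ in atTop, f n (a, x) ≤ ((n : ℝ≥0∞) + 1) ^ 2 * g n x := by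
  have hn0 : ∀ n : ℕ, ((n : ℝ≥0∞) + 1) ^ 2 ≠ 0 := fun n => by simp
  have hn1 : ∀ n : ℕ, ((n : ℝ≥0∞) + 1) ^ 2 ≠ ∞ := fun n => by finiteness
  -- The series has finite integral because the weights cancel `g n x` and leave a multiple of `1 /
  -- (n + 1) ^ 2`. Where it converges, its terms are eventually at most `1`.
  let F : α × β → ℝ≥0∞ := fun p => ∑' n : ℕ, (((n : ℝ≥0∞) + 1) ^ 2 * g n p.2)⁻¹ * f n p
  have hFm : Measurable F :=
    Measurable.tsum fun n => ((((hg n).comp measurable_snd).const_mul _).inv).mul (hf n)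
  have hF : ∫⁻ a, ∫⁻ x, F (a, x) ∂μ ∂ν ≠ ∞ := by
    rw [lintegral_lintegral_swap (f := fun a x => F (a, x)) hFm.aemeasurable]
    have hx : ∀ x, ∫⁻ a, F (a, x) ∂ν ≤ C * ∑' n : ℕ, (((n : ℝ≥0∞) + 1) ^ 2)⁻¹ := by
      intro x
      have hm : ∀ n : ℕ, Measurable fun a => f n (a, x) := fun n =>
        (hf n).comp measurable_prodMk_right
      simp only [F]
      rw [lintegral_tsum fun n => ((hm n).const_mul _).aemeasurable, ← ENNReal.tsum_mul_left]
      refine ENNReal.tsum_le_tsum fun n => ?_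
      rw [lintegral_const_mul _ (hm n)]
      refine (mul_le_mul_right (hfg n x) _).trans (le_of_eq ?_)
      rw [ENNReal.mul_inv (Or.inl (hn0 n)) (Or.inl (hn1 n))]
      have := ENNReal.inv_mul_cancel (hg0 n x) (hg1 n x)
      calc _ = C * (((n : ℝ≥0∞) + 1) ^ 2)⁻¹ * ((g n x)⁻¹ * g n x) := by ring
        _ = _ := by rw [this, mul_one]
    refine ne_top_of_le_ne_top ?_ (lintegral_mono hx)
    rw [lintegral_const]
    exact ENNReal.mul_ne_top (ENNReal.mul_ne_top hC tsum_inv_sq_ne_top) (measure_ne_top _ _)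
  filter_upwards [ae_lt_top hFm.lintegral_prod_right' hF] with a ha
  filter_upwards [ae_lt_top (hFm.comp measurable_prodMk_left) ha.ne] with x hx
  have h0 := ENNReal.tendsto_atTop_zero_of_tsum_ne_top hx.ne
  filter_upwards [h0.eventually_le_const one_pos] with n hn
  have h1 : ((n : ℝ≥0∞) + 1) ^ 2 * g n x ≠ 0 := mul_ne_zero (hn0 n) (hg0 n x)
  have h2 : ((n : ℝ≥0∞) + 1) ^ 2 * g n x ≠ ∞ := ENNReal.mul_ne_top (hn1 n) (hg1 n x)
  rwa [ENNReal.inv_mul_le_iff h1 h2, mul_one] at hn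

end BorelCantelli

/-! ### Mass of balls against the dyadic sum `H` -/

section Estimates

variable {d m : ℕ} {T : Fin m → Matrix (Fin d) (Fin d) ℝ} {ρ : ℝ} {μ : Measure (Shift m)}

lemma mem_cyl {x y : Shift m} {n : ℕ} : y ∈ cyl x n ↔ ∀ i < n, y i = x i := Iff.rfl

lemma measurableSet_cyl (x : Shift m) (n : ℕ) : MeasurableSet (cyl x n) :=
  (PiNat.isOpen_cylinder (fun _ => Fin m) x n).measurableSet

lemma cyl_congr {x y : Shift m} {n j : ℕ} (h : ∀ i < n, x i = y i) (hj : j ≤ n) :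
    cyl x j = cyl y j := by
  ext z
  rw [mem_cyl, mem_cyl]
  exact forall₂_congr fun i hi => by rw [h i (by omega)]

/-- A dyadic version of `G T μ x`. -/
def H (T : Fin m → Matrix (Fin d) (Fin d) ℝ) (μ : Measure (Shift m)) (n : ℕ) (x : Shift m) :
    ℝ≥0∞ :=
  ∑ j ∈ Finset.range (n + 1), μ (cyl x j) * ENNReal.ofReal (zfun (wordMat T x j) ((1 / 2) ^ n))

lemma measurable_H (T : Fin m → Matrix (Fin d) (Fin d) ℝ) (μ : Measure (Shift m)) (n : ℕ) :
    Measurable (H T μ n) := by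
  refine (isLocallyConstant_of_cylinder n fun x y h => ?_).continuous.measurable
  refine Finset.sum_congr rfl fun j hj => ?_
  have hj : j ≤ n := by have := Finset.mem_range.1 hj; omega
  rw [cyl_congr h hj, wordMat_congr fun i hi => h i (by omega)]

lemma H_ne_top [IsFiniteMeasure μ] (n : ℕ) (x : Shift m) : H T μ n x ≠ ∞ :=
  ENNReal.sum_ne_top.2 fun _ _ => ENNReal.mul_ne_top (measure_ne_top _ _) ENNReal.ofReal_ne_top

lemma H_ne_zero [IsProbabilityMeasure μ] (hT : ∀ i, IsUnit (T i)) (n : ℕ) (x : Shift m) :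
    H T μ n x ≠ 0 := by
  refine ne_of_gt (lt_of_lt_of_le ?_ (Finset.single_le_sum (fun _ _ => zero_le)
    (Finset.mem_range.2 n.succ_pos)))
  have h0 : cyl x 0 = Set.univ := PiNat.cylinder_zero x
  rw [h0, measure_univ, one_mul, ENNReal.ofReal_pos]
  exact zfun_pos (isUnit_wordMat hT x 0) (by positivity)

lemma opNorm_wordMat_le_half (hρ0 : 0 ≤ ρ) (hρ1 : ρ < 1 / 2) (hρ : ∀ i, opNorm (T i) ≤ ρ)
    (x : Shift m) (n : ℕ) : opNorm (wordMat T x n) ≤ (1 / 2) ^ n :=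
  (opNorm_wordMat_le hρ0 hρ x n).trans (pow_le_pow_left₀ hρ0 hρ1.le n)

lemma exists_first_difference (x y : Shift m) (n : ℕ) :
    (∀ i < n, x i = y i) ∨ ∃ j < n, (∀ i < j, x i = y i) ∧ x j ≠ y j := by
  classical
  by_cases h : ∃ j, j < n ∧ x j ≠ y j
  · right
    refine ⟨Nat.find h, (Nat.find_spec h).1, fun i hi => ?_, (Nat.find_spec h).2⟩
    by_contra hne
    exact Nat.find_min h hi ⟨hi.trans (Nat.find_spec h).1, hne⟩
  · left
    push Not at h
    exact h

/-- A function which is bounded on `cyl x j \ cyl x (j + 1)` by `C * zfun (T_{x|j})` has integral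
at most `C * H`. -/
lemma lintegral_le_mul_H (hT : ∀ i, IsUnit (T i)) (hρ0 : 0 ≤ ρ) (hρ1 : ρ < 1 / 2)
    (hρ : ∀ i, opNorm (T i) ≤ ρ) {f : Shift m → ℝ≥0∞} {C : ℝ≥0∞} {x : Shift m} {n : ℕ}
    (hC : ∀ y, f y ≤ C)
    (hf : ∀ y j, (∀ i < j, x i = y i) → x j ≠ y j →
      f y ≤ C * ENNReal.ofReal (zfun (wordMat T x j) ((1 / 2) ^ n))) :
    ∫⁻ y, f y ∂μ ≤ C * H T μ n x := by
  have hle : ∀ y, f y ≤ ∑ j ∈ Finset.range (n + 1), (cyl x j).indicator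
      (fun _ => C * ENNReal.ofReal (zfun (wordMat T x j) ((1 / 2) ^ n))) y := by
    intro y
    obtain ⟨j, hj, hjy, hfj⟩ : ∃ j < n + 1, y ∈ cyl x j ∧
        f y ≤ C * ENNReal.ofReal (zfun (wordMat T x j) ((1 / 2) ^ n)) := by
      rcases exists_first_difference x y n with h | ⟨j, hj, h, hne⟩
      -- If `n` letters agree, `T_{x|n}` has norm at most `2^(-n)`, so the last weight is `1` and
      -- the uniform bound suffices.
      · refine ⟨n, n.lt_succ_self, fun i hi => (h i hi).symm, ?_⟩
        rw [zfun_eq_one (isUnit_wordMat hT x n) (opNorm_wordMat_le_half hρ0 hρ1 hρ x n),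
          ENNReal.ofReal_one, mul_one]
        exact hC y
      · exact ⟨j, by omega, fun i hi => (h i hi).symm, hf y j h hne⟩
    refine le_trans ?_ (Finset.single_le_sum (fun _ _ => zero_le) (Finset.mem_range.2 hj))
    rw [Set.indicator_of_mem hjy]
    exact hfj
  refine (lintegral_mono hle).trans ?_
  rw [lintegral_finsetSum _ fun j _ => measurable_const.indicator (measurableSet_cyl x j), H,
    Finset.mul_sum]
  refine Finset.sum_le_sum fun j _ => ?_
  rw [lintegral_indicator_const (measurableSet_cyl x j)]
  exact le_of_eq (by ring)

lemma measurableSet_coding_close (hρ0 : 0 ≤ ρ) (hρ1 : ρ < 1 / 2) (hρ : ∀ i, opNorm (T i) ≤ ρ)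
    (r : ℝ) : MeasurableSet {p : ((Fin m → E d) × Shift m) × Shift m |
      ‖coding T p.1.1 p.1.2 - coding T p.1.1 p.2‖ ≤ r} := by
  have h := measurable_coding (d := d) hρ0 hρ1 hρ
  refine measurableSet_le (Measurable.norm (Measurable.sub ?_ ?_)) measurable_const
  · exact h.comp measurable_fst
  · exact h.comp ((measurable_fst.comp measurable_fst).prodMk measurable_snd)

/-- The points whose images under the coding map are within distance `r` of the image of `x`. -/
def near (T : Fin m → Matrix (Fin d) (Fin d) ℝ) (a : Fin m → E d) (x : Shift m) (r : ℝ) :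
    Set (Shift m) :=
  {y | ‖coding T a x - coding T a y‖ ≤ r}

lemma lintegral_measure_near [SFinite μ] (hρ0 : 0 ≤ ρ) (hρ1 : ρ < 1 / 2)
    (hρ : ∀ i, opNorm (T i) ≤ ρ) (ν : Measure (Fin m → E d)) [SFinite ν] (x : Shift m) (r : ℝ) :
    ∫⁻ a, μ (near T a x r) ∂ν = ∫⁻ y, ν {a | ‖coding T a x - coding T a y‖ ≤ r} ∂μ := by
  have hm : MeasurableSet {p : (Fin m → E d) × Shift m |
      ‖coding T p.1 x - coding T p.1 p.2‖ ≤ r} := by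
    have h := measurableSet_coding_close (d := d) hρ0 hρ1 hρ r
    have h2 : Measurable fun p : (Fin m → E d) × Shift m => ((p.1, x), p.2) := by fun_prop
    exact h2 h
  exact lintegral_measure_swap ν μ hm

lemma exists_lintegral_near_le [IsProbabilityMeasure μ] (hT : ∀ i, IsUnit (T i)) (hρ0 : 0 ≤ ρ)
    (hρ1 : ρ < 1 / 2) (hρ : ∀ i, opNorm (T i) ≤ ρ) {R : ℝ} (hR : 1 ≤ R) :
    ∃ C : ℝ≥0∞, C ≠ ∞ ∧ ∀ (n : ℕ) (x : Shift m),
      ∫⁻ a in paramBox d m R, μ (near T a x ((1 / 2) ^ n)) ≤ C * H T μ n x := by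
  obtain ⟨C, hC, hvol⟩ := exists_volume_coding_sub_le (d := d) hT hρ0 hρ1 hρ hR
  -- The added volume serves as the uniform bound, also for `y = x`, where transversality says
  -- nothing.
  refine ⟨C + volume (paramBox d m R), ENNReal.add_ne_top.2 ⟨hC, volume_paramBox_ne_top R⟩,
    fun n x => ?_⟩
  rw [lintegral_measure_near hρ0 hρ1 hρ]
  refine lintegral_le_mul_H hT hρ0 hρ1 hρ (fun y => ?_) fun y j hj hne => ?_
  · refine (measure_mono (Set.subset_univ _)).trans ?_
    rw [Measure.restrict_apply_univ]
    exact le_add_self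
  · rw [Measure.restrict_apply' (measurableSet_paramBox R)]
    refine (hvol x y j hj hne _ (by positivity)).trans ?_
    gcongr
    exact le_self_add

lemma measurable_measure_near [SFinite μ] (hρ0 : 0 ≤ ρ) (hρ1 : ρ < 1 / 2)
    (hρ : ∀ i, opNorm (T i) ≤ ρ) (r : ℝ) :
    Measurable fun p : (Fin m → E d) × Shift m => μ (near T p.1 p.2 r) :=
  measurable_measure_prodMk_left (measurableSet_coding_close hρ0 hρ1 hρ r)

lemma ae_ae_eventually_measure_near_le [IsProbabilityMeasure μ] (hT : ∀ i, IsUnit (T i))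
    (hρ0 : 0 ≤ ρ) (hρ1 : ρ < 1 / 2) (hρ : ∀ i, opNorm (T i) ≤ ρ) :
    ∀ᵐ a : Fin m → E d, ∀ᵐ x ∂μ, ∀ᶠ n : ℕ in atTop,
      μ (near T a x ((1 / 2) ^ n)) ≤ ((n : ℝ≥0∞) + 1) ^ 2 * H T μ n x := by
  -- Countably many boxes of finite volume exhaust the parameters.
  have hcover : ⋃ N : ℕ, paramBox d m (N + 1) = Set.univ := by
    refine Set.eq_univ_of_forall fun a => Set.mem_iUnion.2 ?_
    obtain ⟨N, hN⟩ := exists_nat_ge ‖a‖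
    exact ⟨N, fun i => (norm_le_pi_norm a i).trans (by linarith)⟩
  rw [← Measure.restrict_univ (μ := (volume : Measure (Fin m → E d))), ← hcover,
    ae_restrict_iUnion_iff]
  intro N
  obtain ⟨C, hC, hint⟩ := exists_lintegral_near_le (d := d) (μ := μ) hT hρ0 hρ1 hρ
    (R := N + 1) (by simp)
  exact ae_ae_eventually_le_of_lintegral_le
    (f := fun n (p : (Fin m → E d) × Shift m) => μ (near T p.1 p.2 ((1 / 2) ^ n)))
    (fun n => measurable_measure_near hρ0 hρ1 hρ _)
    (fun n => measurable_H T μ n) (fun n x => H_ne_zero hT n x) (fun n x => H_ne_top n x) hC hint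

/-- A point of a cylinder is unlikely to have an image with few neighbours. -/
lemma measure_few_near_le [IsProbabilityMeasure μ] (hT : ∀ i, IsUnit (T i)) (hρ0 : 0 ≤ ρ)
    (hρ1 : ρ < 1 / 2) (hρ : ∀ i, opNorm (T i) ≤ ρ) {a : Fin m → E d} {R : ℝ} (hR : 0 ≤ R)
    (ha : ∀ i, ‖a i‖ ≤ R) {r : ℝ} (hr : 0 < r) (j : ℕ) (ε : ℝ≥0∞) :
    μ {x | μ (near T a x r) < ε * (μ (cyl x j) * ENNReal.ofReal (zfun (wordMat T x j) r))}
      ≤ ENNReal.ofReal ((2 * (2 * R) * d + 3) ^ d) * ε := by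
  set A := {x | μ (near T a x r) < ε * (μ (cyl x j) * ENNReal.ofReal (zfun (wordMat T x j) r))}
    with hA
  set K := ENNReal.ofReal ((2 * (2 * R) * d + 3) ^ d)
  -- The nonempty fibres are the cylinders of length `j`; there are finitely many.
  let res : Shift m → Fin j → Fin m := fun x i => x i
  have hres : Measurable res := by fun_prop
  have hfib : ∀ w, μ (A ∩ res ⁻¹' {w}) ≤ K * ε * μ (res ⁻¹' {w}) := by
    intro w
    rcases (A ∩ res ⁻¹' {w}).eq_empty_or_nonempty with hempty | ⟨x₀, -, hx₀⟩
    · simp [hempty]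
    have hagree : ∀ x ∈ res ⁻¹' {w}, ∀ i < j, x i = x₀ i := by
      intro x hx i hi
      have h1 := congrFun (Set.mem_singleton_iff.1 (Set.mem_preimage.1 hx)) ⟨i, hi⟩
      have h2 := congrFun (Set.mem_singleton_iff.1 (Set.mem_preimage.1 hx₀)) ⟨i, hi⟩
      exact h1.trans h2.symm
    have hcyl : res ⁻¹' {w} = cyl x₀ j := by
      refine Set.Subset.antisymm (fun x hx => hagree x hx) fun x hx => ?_
      rw [Set.mem_preimage, Set.mem_singleton_iff] at hx₀ ⊢
      rw [← hx₀]
      funext i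
      exact hx i i.2
    set M := wordMat T x₀ j
    obtain ⟨q, F, hqF, hq, hcard⟩ := exists_cells (isUnit_wordMat hT x₀ j : IsUnit M)
      (by positivity : 0 ≤ 2 * R) hr
    have hsub : A ∩ res ⁻¹' {w} ⊆ ⋃ c ∈ F,
        A ∩ res ⁻¹' {w} ∩ {x | q (coding T a fun i => x (j + i)) = c} := by
      intro x hx
      refine Set.mem_iUnion₂.2 ⟨q (coding T a fun i => x (j + i)), hqF _ ?_, hx, rfl⟩
      exact norm_coding_le hρ0 hρ1 hρ ha _
    refine (measure_mono hsub).trans ((measure_biUnion_finset_le F _).trans ?_)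
    -- Points of a cell have images within `r` of each other, so the part of `A` in a cell is
    -- contained in `near T a x₁ r` for any of its points `x₁`, and that set is small by the
    -- definition of `A`.
    have hcell : ∀ c ∈ F, μ (A ∩ res ⁻¹' {w} ∩ {x | q (coding T a fun i => x (j + i)) = c})
        ≤ ε * (μ (cyl x₀ j) * ENNReal.ofReal (zfun M r)) := by
      intro c _
      rcases (A ∩ res ⁻¹' {w} ∩ {x | q (coding T a fun i => x (j + i)) = c}).eq_empty_or_nonempty
        with hempty | ⟨x₁, ⟨hx₁A, hx₁w⟩, hx₁c⟩
      · rw [hempty, measure_empty]; exact zero_le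
      have h1 := hagree x₁ hx₁w
      have h2 : μ (near T a x₁ r) < ε * (μ (cyl x₀ j) * ENNReal.ofReal (zfun M r)) := by
        have := hx₁A
        rw [hA, Set.mem_ofPred_eq, cyl_congr h1 le_rfl, wordMat_congr h1] at this
        exact this
      refine (measure_mono ?_).trans h2.le
      rintro x ⟨⟨-, hxw⟩, hxc⟩
      have h3 := hagree x hxw
      rw [near, Set.mem_ofPred_eq, coding_sub_coding hρ0 hρ1 hρ a
        (fun i hi => (h1 i hi).trans (h3 i hi).symm), map_sub, wordMat_congr h1]
      exact hq _ _ (hx₁c.trans hxc.symm)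
    refine (Finset.sum_le_sum hcell).trans ?_
    rw [Finset.sum_const, nsmul_eq_mul, hcyl]
    have h4 : (F.card : ℝ≥0∞) * ENNReal.ofReal (zfun M r) ≤ K := by
      rw [← ENNReal.ofReal_natCast, ← ENNReal.ofReal_mul (by positivity)]
      exact ENNReal.ofReal_le_ofReal hcard
    calc _ = (F.card : ℝ≥0∞) * ENNReal.ofReal (zfun M r) * ε * μ (cyl x₀ j) := by ring
      _ ≤ K * ε * μ (cyl x₀ j) := by gcongr
  have hunion : A ⊆ ⋃ w ∈ (Finset.univ : Finset (Fin j → Fin m)), A ∩ res ⁻¹' {w} := by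
    intro x hx
    exact Set.mem_iUnion₂.2 ⟨res x, Finset.mem_univ _, hx, rfl⟩
  refine (measure_mono hunion).trans ((measure_biUnion_finset_le _ _).trans
    ((Finset.sum_le_sum fun w _ => hfib w).trans ?_))
  rw [← Finset.mul_sum, sum_measure_preimage_singleton _ fun w _ => hres (measurableSet_singleton w)]
  simp

lemma ae_eventually_H_le [IsProbabilityMeasure μ] (hT : ∀ i, IsUnit (T i)) (hρ0 : 0 ≤ ρ)
    (hρ1 : ρ < 1 / 2) (hρ : ∀ i, opNorm (T i) ≤ ρ) (a : Fin m → E d) :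
    ∀ᵐ x ∂μ, ∀ᶠ n : ℕ in atTop,
      H T μ n x ≤ ((n : ℝ≥0∞) + 1) ^ 4 * μ (near T a x ((1 / 2) ^ n)) := by
  set K := ENNReal.ofReal ((2 * (2 * ‖a‖) * d + 3) ^ d)
  -- The exponent `3` leaves a summable `1 / (n + 1) ^ 2` after the union over `n + 1` prefix
  -- lengths.
  let ε : ℕ → ℝ≥0∞ := fun n => (((n : ℝ≥0∞) + 1) ^ 3)⁻¹
  let A : ℕ → ℕ → Set (Shift m) := fun n j => {x | μ (near T a x ((1 / 2) ^ n))
    < ε n * (μ (cyl x j) * ENNReal.ofReal (zfun (wordMat T x j) ((1 / 2) ^ n)))}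
  have hA : ∀ n, μ (⋃ j ∈ Finset.range (n + 1), A n j) ≤ K * (((n : ℝ≥0∞) + 1) ^ 2)⁻¹ := by
    intro n
    refine (measure_biUnion_finset_le _ _).trans ((Finset.sum_le_sum fun j _ =>
      measure_few_near_le hT hρ0 hρ1 hρ (norm_nonneg a) (norm_le_pi_norm a)
        (by positivity) j (ε n)).trans ?_)
    rw [Finset.sum_const, Finset.card_range, nsmul_eq_mul, Nat.cast_add, Nat.cast_one]
    have h1 : (n : ℝ≥0∞) + 1 ≠ 0 := by simp
    have h2 : (n : ℝ≥0∞) + 1 ≠ ∞ := by finiteness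
    have h3 : ε n = ((n : ℝ≥0∞) + 1)⁻¹ * (((n : ℝ≥0∞) + 1) ^ 2)⁻¹ := by
      simp only [ε]
      rw [← ENNReal.mul_inv (Or.inl h1) (Or.inl h2), ← pow_succ']
    rw [h3]
    have h4 := ENNReal.mul_inv_cancel h1 h2
    calc _ = K * (((n : ℝ≥0∞) + 1) * ((n : ℝ≥0∞) + 1)⁻¹) * (((n : ℝ≥0∞) + 1) ^ 2)⁻¹ := by ring
      _ ≤ _ := by rw [h4, mul_one]
  have hsum : ∑' n, μ (⋃ j ∈ Finset.range (n + 1), A n j) ≠ ∞ := by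
    refine ne_top_of_le_ne_top ?_ (ENNReal.tsum_le_tsum hA)
    rw [ENNReal.tsum_mul_left]
    exact ENNReal.mul_ne_top ENNReal.ofReal_ne_top tsum_inv_sq_ne_top
  filter_upwards [ae_eventually_notMem hsum] with x hx
  filter_upwards [hx] with n hn
  have h1 : ∀ j ∈ Finset.range (n + 1),
      μ (cyl x j) * ENNReal.ofReal (zfun (wordMat T x j) ((1 / 2) ^ n))
        ≤ ((n : ℝ≥0∞) + 1) ^ 3 * μ (near T a x ((1 / 2) ^ n)) := by
    intro j hj
    have h2 : x ∉ A n j := fun h => hn (Set.mem_iUnion₂.2 ⟨j, hj, h⟩)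
    have h3 : ε n * (μ (cyl x j) * ENNReal.ofReal (zfun (wordMat T x j) ((1 / 2) ^ n)))
        ≤ μ (near T a x ((1 / 2) ^ n)) := not_lt.1 h2
    rwa [ENNReal.inv_mul_le_iff (by simp) (by finiteness)] at h3
  refine (Finset.sum_le_sum h1).trans ?_
  rw [Finset.sum_const, Finset.card_range, nsmul_eq_mul, Nat.cast_add, Nat.cast_one]
  exact le_of_eq (by ring)

end Estimates

/-! ### The potential `G` and its comparison with `H` and with balls -/

section Potential

variable {d m : ℕ} {T : Fin m → Matrix (Fin d) (Fin d) ℝ} {ρ : ℝ} {μ : Measure (Shift m)}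

lemma Z_eq_of_ne {x y : Shift m} {j : ℕ} (h : ∀ i < j, x i = y i) (hne : x j ≠ y j) (r : ℝ) :
    Z T x y r = zfun (wordMat T x j) r := by
  have hxy : x ≠ y := fun h => hne (congrFun h j)
  have hj : PiNat.firstDiff (E := fun _ => Fin m) x y = j := by
    refine le_antisymm ?_ ?_
    · by_contra hlt
      exact hne (PiNat.apply_eq_of_lt_firstDiff (not_le.1 hlt))
    · by_contra hlt
      exact PiNat.apply_firstDiff_ne hxy (h _ (not_le.1 hlt))
  rw [Z, if_neg hxy, hj]
  rfl

lemma Z_nonneg (x y : Shift m) {r : ℝ} (hr : 0 ≤ r) : 0 ≤ Z T x y r := by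
  unfold Z
  split_ifs
  · exact zero_le_one
  · exact zfun_nonneg _ hr

lemma Z_le_one (x y : Shift m) {r : ℝ} (hr : 0 ≤ r) : Z T x y r ≤ 1 := by
  unfold Z
  split_ifs
  · exact le_rfl
  · exact zfun_le_one _ hr

lemma Z_mono (x y : Shift m) {r r' : ℝ} (hr : 0 ≤ r) (h : r ≤ r') : Z T x y r ≤ Z T x y r' := by
  unfold Z
  split_ifs
  · exact le_rfl
  · exact zfun_mono _ hr h

lemma Z_two_mul_le (x y : Shift m) {r : ℝ} (hr : 0 ≤ r) : Z T x y (2 * r) ≤ 2 ^ d * Z T x y r := by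
  unfold Z
  split_ifs
  · rw [mul_one]
    exact one_le_pow₀ one_le_two
  · exact zfun_two_mul_le _ hr

lemma pow_le_Z (hT : ∀ i, IsUnit (T i)) (hρ0 : 0 ≤ ρ) (hρ1 : ρ < 1 / 2)
    (hρ : ∀ i, opNorm (T i) ≤ ρ) (x y : Shift m) {r : ℝ} (hr : 0 ≤ r) (hr1 : r ≤ 1) :
    r ^ d ≤ Z T x y r := by
  unfold Z
  split_ifs
  · exact pow_le_one₀ hr hr1
  · exact pow_le_zfun (isUnit_wordMat hT _ _)
      ((opNorm_wordMat_le hρ0 hρ _ _).trans (pow_le_one₀ hρ0 (by linarith))) hr hr1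

lemma zfun_wordMat_le_Z (hT : ∀ i, IsUnit (T i)) (hρ0 : 0 ≤ ρ) (hρ1 : ρ < 1 / 2)
    (hρ : ∀ i, opNorm (T i) ≤ ρ) {x y : Shift m} {j : ℕ} (hy : y ∈ cyl x j) {r : ℝ} (hr : 0 ≤ r) :
    zfun (wordMat T x j) r ≤ Z T x y r := by
  by_cases hxy : x = y
  · rw [Z, if_pos hxy]
    exact zfun_le_one _ hr
  rw [Z, if_neg hxy]
  obtain ⟨k, hk⟩ := Nat.exists_eq_add_of_le
    ((PiNat.mem_cylinder_iff_le_firstDiff (E := fun _ => Fin m) (Ne.symm hxy) j).1 hy)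
  rw [PiNat.firstDiff_comm, hk]
  change _ ≤ zfun (wordMat T x (j + k)) r
  rw [wordMat_add]
  exact zfun_le_zfun_mul (isUnit_wordMat hT _ _) (isUnit_wordMat hT _ _)
    ((opNorm_wordMat_le hρ0 hρ _ _).trans (pow_le_one₀ hρ0 (by linarith))) hr

/-- When set to `1` on `cyl x n`, the function depends on `n` letters only; these modifications
converge pointwise. -/
lemma measurable_Z (x : Shift m) (r : ℝ) : Measurable fun y => Z T x y r := by
  classical
  refine measurable_of_tendsto_metrizable
    (f := fun n (y : Shift m) => if y ∈ cyl x n then 1 else Z T x y r) (fun n => ?_)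
    (tendsto_pi_nhds.2 fun y => ?_)
  · refine (isLocallyConstant_of_cylinder n fun y z h => ?_).continuous.measurable
    have hyz : y ∈ cyl x n ↔ z ∈ cyl x n :=
      forall₂_congr fun i hi => by rw [h i hi]
    by_cases hy : y ∈ cyl x n
    · rw [if_pos hy, if_pos (hyz.1 hy)]
    · rw [if_neg hy, if_neg (hyz.not.1 hy)]
      rcases exists_first_difference x y n with h' | ⟨j, hj, h', hne⟩
      · exact absurd (fun i hi => (h' i hi).symm) hy
      · rw [Z_eq_of_ne h' hne, Z_eq_of_ne (fun i hi => (h' i hi).trans (h i (by omega)))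
          (by rwa [← h j hj])]
  · by_cases hxy : x = y
    · refine tendsto_const_nhds.congr fun n => ?_
      rw [if_pos (hxy ▸ PiNat.self_mem_cylinder x n), Z, if_pos hxy]
    · refine tendsto_const_nhds.congr' ?_
      obtain ⟨j, hj⟩ := Function.ne_iff.1 hxy
      filter_upwards [eventually_gt_atTop j] with n hn
      rw [if_neg fun h => hj (h j hn).symm]

lemma integrable_Z [IsFiniteMeasure μ] (x : Shift m) {r : ℝ} (hr : 0 ≤ r) :
    Integrable (fun y => Z T x y r) μ := by
  refine Integrable.of_bound (measurable_Z x r).aestronglyMeasurable 1 (ae_of_all _ fun y => ?_)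
  rw [Real.norm_eq_abs, abs_of_nonneg (Z_nonneg x y hr)]
  exact Z_le_one x y hr

variable [IsProbabilityMeasure μ]

lemma G_mono (x : Shift m) {r r' : ℝ} (hr : 0 ≤ r) (h : r ≤ r') : G T μ x r ≤ G T μ x r' :=
  integral_mono (integrable_Z x hr) (integrable_Z x (hr.trans h)) fun y => Z_mono x y hr h

lemma G_two_mul_le (x : Shift m) {r : ℝ} (hr : 0 ≤ r) : G T μ x (2 * r) ≤ 2 ^ d * G T μ x r := by
  unfold G
  rw [← integral_const_mul]
  exact integral_mono (integrable_Z x (by linarith)) ((integrable_Z x hr).const_mul _)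
    fun y => Z_two_mul_le x y hr

lemma G_le_one (x : Shift m) {r : ℝ} (hr : 0 ≤ r) : G T μ x r ≤ 1 := by
  refine (integral_mono (integrable_Z x hr) (integrable_const 1) fun y => Z_le_one x y hr).trans ?_
  simp

lemma pow_le_G (hT : ∀ i, IsUnit (T i)) (hρ0 : 0 ≤ ρ) (hρ1 : ρ < 1 / 2)
    (hρ : ∀ i, opNorm (T i) ≤ ρ) (x : Shift m) {r : ℝ} (hr : 0 ≤ r) (hr1 : r ≤ 1) :
    r ^ d ≤ G T μ x r := by
  refine le_trans ?_ (integral_mono (integrable_const (r ^ d)) (integrable_Z x hr)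
    fun y => pow_le_Z hT hρ0 hρ1 hρ x y hr hr1)
  simp

lemma G_pos (hT : ∀ i, IsUnit (T i)) (hρ0 : 0 ≤ ρ) (hρ1 : ρ < 1 / 2)
    (hρ : ∀ i, opNorm (T i) ≤ ρ) (x : Shift m) {r : ℝ} (hr : 0 < r) : 0 < G T μ x r := by
  refine lt_of_lt_of_le (pow_pos (lt_min hr one_pos) d) ((pow_le_G hT hρ0 hρ1 hρ x
    (le_min hr.le zero_le_one) (min_le_right r 1)).trans
    (G_mono x (le_min hr.le zero_le_one) (min_le_left r 1)))

lemma measureReal_cyl_mul_zfun_le_G (hT : ∀ i, IsUnit (T i)) (hρ0 : 0 ≤ ρ) (hρ1 : ρ < 1 / 2)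
    (hρ : ∀ i, opNorm (T i) ≤ ρ) (x : Shift m) (j : ℕ) {r : ℝ} (hr : 0 ≤ r) :
    μ.real (cyl x j) * zfun (wordMat T x j) r ≤ G T μ x r := by
  have h : ∀ y, (cyl x j).indicator (fun _ => zfun (wordMat T x j) r) y ≤ Z T x y r := by
    intro y
    by_cases hy : y ∈ cyl x j
    · rw [Set.indicator_of_mem hy]
      exact zfun_wordMat_le_Z hT hρ0 hρ1 hρ hy hr
    · rw [Set.indicator_of_notMem hy]
      exact Z_nonneg x y hr
  refine le_trans (le_of_eq ?_) (integral_mono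
    ((integrable_const _).indicator (measurableSet_cyl x j)) (integrable_Z x hr) h)
  rw [integral_indicator_const _ (measurableSet_cyl x j), smul_eq_mul]

lemma ofReal_G_le_H (hT : ∀ i, IsUnit (T i)) (hρ0 : 0 ≤ ρ) (hρ1 : ρ < 1 / 2)
    (hρ : ∀ i, opNorm (T i) ≤ ρ) (n : ℕ) (x : Shift m) :
    ENNReal.ofReal (G T μ x ((1 / 2) ^ n)) ≤ H T μ n x := by
  have hr : (0 : ℝ) ≤ (1 / 2) ^ n := by positivity
  rw [G, ofReal_integral_eq_lintegral_ofReal (integrable_Z x hr)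
    (ae_of_all _ fun y => Z_nonneg x y hr)]
  refine (lintegral_le_mul_H hT hρ0 hρ1 hρ (C := 1) (fun y => ?_) fun y j h hne => ?_).trans_eq
    (one_mul _)
  · exact ENNReal.ofReal_le_one.2 (Z_le_one x y hr)
  · rw [one_mul, Z_eq_of_ne h hne]

lemma H_le_mul_G (hT : ∀ i, IsUnit (T i)) (hρ0 : 0 ≤ ρ) (hρ1 : ρ < 1 / 2)
    (hρ : ∀ i, opNorm (T i) ≤ ρ) (n : ℕ) (x : Shift m) :
    H T μ n x ≤ ((n : ℝ≥0∞) + 1) * ENNReal.ofReal (G T μ x ((1 / 2) ^ n)) := by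
  have hr : (0 : ℝ) ≤ (1 / 2) ^ n := by positivity
  have h : ∀ j ∈ Finset.range (n + 1),
      μ (cyl x j) * ENNReal.ofReal (zfun (wordMat T x j) ((1 / 2) ^ n))
        ≤ ENNReal.ofReal (G T μ x ((1 / 2) ^ n)) := by
    intro j _
    rw [← ofReal_measureReal, ← ENNReal.ofReal_mul measureReal_nonneg]
    exact ENNReal.ofReal_le_ofReal (measureReal_cyl_mul_zfun_le_G hT hρ0 hρ1 hρ x j hr)
  refine (Finset.sum_le_sum h).trans (le_of_eq ?_)
  rw [Finset.sum_const, Finset.card_range, nsmul_eq_mul, Nat.cast_add, Nat.cast_one]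

/-- For typical translations the mass of a ball around a typical point is comparable to the
potential `G` up to polynomial factors. -/
lemma ae_ae_eventually_measure_near_comparable (hT : ∀ i, IsUnit (T i)) (hρ0 : 0 ≤ ρ)
    (hρ1 : ρ < 1 / 2) (hρ : ∀ i, opNorm (T i) ≤ ρ) :
    ∀ᵐ a : Fin m → E d, ∀ᵐ x ∂μ, ∀ᶠ n : ℕ in atTop,
      μ.real (near T a x ((1 / 2) ^ n)) ≤ ((n : ℝ) + 1) ^ 4 * G T μ x ((1 / 2) ^ n) ∧
      G T μ x ((1 / 2) ^ n) ≤ ((n : ℝ) + 1) ^ 4 * μ.real (near T a x ((1 / 2) ^ n)) := by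
  filter_upwards [ae_ae_eventually_measure_near_le (d := d) (μ := μ) hT hρ0 hρ1 hρ] with a ha
  filter_upwards [ha, ae_eventually_H_le (μ := μ) hT hρ0 hρ1 hρ a] with x hx hx'
  filter_upwards [hx, hx'] with n hn hn'
  have hG := (G_pos (μ := μ) hT hρ0 hρ1 hρ x (by positivity : (0 : ℝ) < (1 / 2) ^ n)).le
  have hcast : ∀ k : ℕ, ((n : ℝ≥0∞) + 1) ^ k = ENNReal.ofReal (((n : ℝ) + 1) ^ k) := by
    intro k
    rw [ENNReal.ofReal_pow (by positivity), ENNReal.ofReal_add (by positivity) zero_le_one,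
      ENNReal.ofReal_natCast, ENNReal.ofReal_one]
  constructor
  · have h1 : μ (near T a x ((1 / 2) ^ n))
        ≤ ((n : ℝ≥0∞) + 1) ^ 3 * ENNReal.ofReal (G T μ x ((1 / 2) ^ n)) := by
      refine hn.trans ((mul_le_mul_right (H_le_mul_G hT hρ0 hρ1 hρ n x) _).trans
        (le_of_eq (by ring)))
    rw [hcast, ← ENNReal.ofReal_mul (by positivity)] at h1
    refine (ENNReal.toReal_le_of_le_ofReal (by positivity) h1).trans ?_
    refine mul_le_mul_of_nonneg_right (pow_le_pow_right₀ ?_ (by norm_num)) hG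
    linarith [n.cast_nonneg (α := ℝ)]
  · have h1 := (ofReal_G_le_H hT hρ0 hρ1 hρ n x).trans hn'
    rw [hcast, ← ofReal_measureReal, ← ENNReal.ofReal_mul (by positivity)] at h1
    exact (ENNReal.ofReal_le_ofReal_iff (by positivity)).1 h1

end Potential

/-! ### From dyadic radii to all radii; absorbing polynomial factors -/

section Asymptotics

lemma eventually_of_dyadic {P : ℝ → Prop}
    (h : ∀ᶠ n : ℕ in atTop, ∀ r : ℝ, (1 / 2) ^ (n + 1) < r → r ≤ (1 / 2) ^ n → P r) :
    ∀ᶠ r in 𝓝[>] (0 : ℝ), P r := by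
  obtain ⟨N, hN⟩ := eventually_atTop.1 h
  have h1 : Set.Ioo (0 : ℝ) ((1 / 2) ^ N) ∈ 𝓝[>] (0 : ℝ) := Ioo_mem_nhdsGT (by positivity)
  filter_upwards [h1] with r hr
  have hr1 : r ≤ 1 := hr.2.le.trans (pow_le_one₀ (by norm_num) (by norm_num))
  obtain ⟨n, hn, hn'⟩ := exists_nat_pow_near_of_lt_one hr.1 hr1
    (by norm_num : (0 : ℝ) < 1 / 2) (by norm_num)
  refine hN n ?_ r hn hn'
  have h2 := (pow_lt_pow_iff_right_of_lt_one₀ (by norm_num : (0 : ℝ) < 1 / 2) (by norm_num)).1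
    (hn.trans hr.2)
  omega

/-- The shift `n + 2` covers dyadic estimates used at level `n` as well as at level `n + 1`. -/
lemma eventually_mul_pow_le_pow (K : ℝ) {b : ℝ} (hb : 1 < b) :
    ∀ᶠ n : ℕ in atTop, K * ((n : ℝ) + 2) ^ 4 ≤ b ^ n := by
  have h := ((tendsto_add_atTop_iff_nat 2).2
    (tendsto_pow_const_div_const_pow_of_one_lt 4 hb)).const_mul (K * b ^ 2)
  rw [mul_zero] at h
  filter_upwards [h.eventually_le_const one_pos] with n hn
  have hb0 : 0 < b ^ n := by positivity
  have hb2 : 0 < b ^ 2 := by positivity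
  push_cast at hn
  have h1 : K * b ^ 2 * (((n : ℝ) + 2) ^ 4 / b ^ (n + 2)) = K * ((n : ℝ) + 2) ^ 4 / b ^ n := by
    rw [pow_add]
    field_simp
  rwa [h1, div_le_one hb0] at hn

lemma eventually_mul_pow_le_rpow_neg (K : ℝ) {ε : ℝ} (hε : 0 < ε) :
    ∀ᶠ n : ℕ in atTop, ∀ r : ℝ, 0 < r → r ≤ (1 / 2) ^ n → K * ((n : ℝ) + 2) ^ 4 ≤ r ^ (-ε) := by
  filter_upwards [eventually_mul_pow_le_pow K (Real.one_lt_rpow one_lt_two hε)] with n hn r hr hrn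
  refine hn.trans ?_
  have h1 : ((2 : ℝ) ^ ε) ^ n = ((1 / 2 : ℝ) ^ n) ^ (-ε) := by
    rw [← Real.rpow_natCast, ← Real.rpow_natCast, ← Real.rpow_mul zero_le_two,
      ← Real.rpow_mul (by norm_num), one_div, Real.inv_rpow zero_le_two,
      ← Real.rpow_neg zero_le_two]
    congr 1
    ring
  rw [h1]
  exact Real.rpow_le_rpow_of_nonpos hr hrn (by linarith)

/-- Passing from dyadic radii to all radii when the upper bound is doubling. -/
lemma eventually_le_rpow_mul_of_doubling_right {f g : ℝ → ℝ} {C K : ℝ} (hC : 0 ≤ C)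
    (hf : ∀ r r', 0 < r → r ≤ r' → f r ≤ f r') (hg : ∀ r r', 0 < r → r ≤ r' → g r ≤ g r')
    (hg0 : ∀ r, 0 < r → 0 ≤ g r) (hg2 : ∀ r, 0 < r → g (2 * r) ≤ K * g r)
    (h : ∀ᶠ n : ℕ in atTop, f ((1 / 2) ^ n) ≤ C * ((n : ℝ) + 1) ^ 4 * g ((1 / 2) ^ n))
    {ε : ℝ} (hε : 0 < ε) : ∀ᶠ r in 𝓝[>] (0 : ℝ), f r ≤ r ^ (-ε) * g r := by
  refine eventually_of_dyadic ?_
  filter_upwards [h, eventually_mul_pow_le_rpow_neg (C * |K|) hε] with n hn hK r hr hr'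
  have hr0 : 0 < r := lt_trans (by positivity) hr
  have h2 : (1 / 2 : ℝ) ^ n ≤ 2 * r := by
    rw [pow_succ] at hr
    linarith
  calc f r ≤ f ((1 / 2) ^ n) := hf _ _ hr0 hr'
    _ ≤ C * ((n : ℝ) + 1) ^ 4 * g ((1 / 2) ^ n) := hn
    _ ≤ C * ((n : ℝ) + 2) ^ 4 * (|K| * g r) := by
        gcongr
        · exact hg0 _ (by positivity)
        · linarith
        · exact (hg _ _ (by positivity) h2).trans ((hg2 r hr0).trans
            (mul_le_mul_of_nonneg_right (le_abs_self K) (hg0 r hr0)))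
    _ = C * |K| * ((n : ℝ) + 2) ^ 4 * g r := by ring
    _ ≤ _ := mul_le_mul_of_nonneg_right (hK r hr0 hr') (hg0 r hr0)

/-- Passing from dyadic radii to all radii when the lower bound is doubling. -/
lemma eventually_le_rpow_mul_of_doubling_left {f g : ℝ → ℝ} {K : ℝ}
    (hf : ∀ r r', 0 < r → r ≤ r' → f r ≤ f r') (hg : ∀ r r', 0 < r → r ≤ r' → g r ≤ g r')
    (hf0 : ∀ r, 0 < r → 0 ≤ f r) (hg0 : ∀ r, 0 < r → 0 ≤ g r)
    (hf2 : ∀ r, 0 < r → f (2 * r) ≤ K * f r)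
    (h : ∀ᶠ n : ℕ in atTop, f ((1 / 2) ^ n) ≤ ((n : ℝ) + 1) ^ 4 * g ((1 / 2) ^ n))
    {ε : ℝ} (hε : 0 < ε) : ∀ᶠ r in 𝓝[>] (0 : ℝ), f r ≤ r ^ (-ε) * g r := by
  refine eventually_of_dyadic ?_
  filter_upwards [(tendsto_add_atTop_nat 1).eventually h, eventually_mul_pow_le_rpow_neg |K| hε]
    with n hn hK r hr hr'
  have hr0 : 0 < r := lt_trans (by positivity) hr
  have h2 : (2 : ℝ) * (1 / 2) ^ (n + 1) = (1 / 2) ^ n := by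
    rw [pow_succ]
    ring
  have h3 : ((n + 1 : ℕ) : ℝ) + 1 = n + 2 := by
    push_cast
    ring
  rw [h3] at hn
  calc f r ≤ f (2 * (1 / 2) ^ (n + 1)) := hf _ _ hr0 (by rwa [h2])
    _ ≤ |K| * f ((1 / 2) ^ (n + 1)) := (hf2 _ (by positivity)).trans
        (mul_le_mul_of_nonneg_right (le_abs_self K) (hf0 _ (by positivity)))
    _ ≤ |K| * (((n : ℝ) + 2) ^ 4 * g r) := by
        refine mul_le_mul_of_nonneg_left (hn.trans ?_) (abs_nonneg K)
        exact mul_le_mul_of_nonneg_left (hg _ _ (by positivity) hr.le) (by positivity)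
    _ = |K| * ((n : ℝ) + 2) ^ 4 * g r := by ring
    _ ≤ _ := mul_le_mul_of_nonneg_right (hK r hr0 hr') (hg0 r hr0)

lemma log_div_log_le_add_of_le_rpow_mul {u v r ε : ℝ} (hu : 0 < u) (hv : 0 < v) (hr : 0 < r)
    (hr1 : r < 1) (h : u ≤ r ^ (-ε) * v) :
    Real.log v / Real.log r ≤ Real.log u / Real.log r + ε := by
  have hlog : Real.log r < 0 := Real.log_neg hr hr1
  have h1 := Real.log_le_log hu h
  rw [Real.log_mul (Real.rpow_pos_of_pos hr _).ne' hv.ne', Real.log_rpow hr] at h1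
  have h2 : Real.log u / Real.log r + ε = (Real.log u + ε * Real.log r) / Real.log r := by
    rw [add_div, mul_div_cancel_right₀ _ hlog.ne]
  rw [h2]
  exact div_le_div_of_nonpos_of_le hlog.le (by linarith)

lemma limsup_coe_le_of_eventually_le_add {α : Type*} {l : Filter α} {f g : α → ℝ}
    (h : ∀ ε > 0, ∀ᶠ x in l, f x ≤ g x + ε) :
    limsup (fun x => (f x : EReal)) l ≤ limsup (fun x => (g x : EReal)) l := by
  refine le_of_forall_gt_imp_ge_of_dense fun c hc => ?_
  obtain ⟨q, hq, hqc⟩ := EReal.lt_iff_exists_real_btwn.1 hc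
  obtain ⟨q', hq', hqc'⟩ := EReal.lt_iff_exists_real_btwn.1 hqc
  have hqq : q < q' := EReal.coe_lt_coe_iff.1 hq'
  refine le_trans (limsup_le_of_le (by isBoundedDefault) ?_) hqc'.le
  filter_upwards [eventually_lt_of_limsup_lt hq, h (q' - q) (by linarith)] with x hx hx'
  rw [EReal.coe_lt_coe_iff] at hx
  rw [EReal.coe_le_coe_iff]
  linarith

lemma liminf_coe_le_of_eventually_le_add {α : Type*} {l : Filter α} {f g : α → ℝ}
    (h : ∀ ε > 0, ∀ᶠ x in l, f x ≤ g x + ε) :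
    liminf (fun x => (f x : EReal)) l ≤ liminf (fun x => (g x : EReal)) l := by
  refine le_of_forall_lt_imp_le_of_dense fun c hc => ?_
  obtain ⟨q, hcq, hq⟩ := EReal.lt_iff_exists_real_btwn.1 hc
  obtain ⟨q', hcq', hq'⟩ := EReal.lt_iff_exists_real_btwn.1 hcq
  have hqq : q' < q := EReal.coe_lt_coe_iff.1 hq'
  refine le_trans hcq'.le (le_liminf_of_le (by isBoundedDefault) ?_)
  filter_upwards [eventually_lt_of_lt_liminf hq, h (q - q') (by linarith)] with x hx hx'
  rw [EReal.coe_lt_coe_iff] at hx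
  rw [EReal.coe_le_coe_iff]
  linarith

end Asymptotics

/-! ### Almost everywhere statements under push-forward -/

section AlmostEverywhere

/-- No measurability of `P` is assumed. Compact sets on which `P ∘ f` holds exhaust the mass, and
their images are compact, hence measurable. -/
lemma ae_map_of_ae_of_continuous {X Y : Type*} [TopologicalSpace X] [T2Space X]
    [MeasurableSpace X] [OpensMeasurableSpace X] [TopologicalSpace Y] [T2Space Y]
    [MeasurableSpace Y] [BorelSpace Y] {μ : Measure X} [IsFiniteMeasure μ]
    [μ.InnerRegularCompactLTTop] {f : X → Y} (hf : Continuous f)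
    {P : Y → Prop} (h : ∀ᵐ x ∂μ, P (f x)) : ∀ᵐ y ∂(μ.map f), P y := by
  rw [ae_iff] at h ⊢
  set t := toMeasurable μ {x | ¬P (f x)}
  have ht : μ t = 0 := by rw [measure_toMeasurable, h]
  have htm : MeasurableSet t := measurableSet_toMeasurable _ _
  refine nonpos_iff_eq_zero.1 (le_of_forall_pos_le_add fun ε hε => ?_)
  obtain ⟨K, hKt, hK, hKε⟩ := htm.compl.exists_isCompact_sdiff_lt (measure_ne_top μ _) hε.ne'
  have hsub : {y | ¬P y} ⊆ (f '' K)ᶜ := by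
    rintro y hy ⟨x, hx, rfl⟩
    exact hKt hx (subset_toMeasurable μ _ hy)
  rw [zero_add]
  calc μ.map f {y | ¬P y} ≤ μ.map f (f '' K)ᶜ := measure_mono hsub
    _ = μ (f ⁻¹' (f '' K)ᶜ) :=
        Measure.map_apply hf.measurable (hK.image hf).measurableSet.compl
    _ ≤ μ (t ∪ (tᶜ \ K)) := by
        refine measure_mono fun x hx => ?_
        by_cases hxt : x ∈ t
        · exact Or.inl hxt
        · exact Or.inr ⟨hxt, fun hxK => hx ⟨x, hxK, rfl⟩⟩
    _ ≤ μ t + μ (tᶜ \ K) := measure_union_le _ _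
    _ ≤ ε := by rw [ht, zero_add]; exact hKε.le

end AlmostEverywhere

/-! ### Local dimensions in terms of `G` and `S` -/

section LocalDimensions

variable {d m : ℕ} {T : Fin m → Matrix (Fin d) (Fin d) ℝ} {ρ : ℝ} {μ : Measure (Shift m)}

lemma continuous_coding (hρ0 : 0 ≤ ρ) (hρ1 : ρ < 1 / 2) (hρ : ∀ i, opNorm (T i) ≤ ρ)
    (a : Fin m → E d) : Continuous (coding T a) := by
  have h : coding T a = fun x => ∑' k, codingTerm T a x k :=
    funext fun x => coding_eq hρ0 hρ1 hρ a x
  rw [h]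
  refine continuous_tsum (fun k => ?_)
    ((summable_geometric_of_lt_one hρ0 (by linarith)).mul_right ‖a‖) fun k x =>
      (norm_codingTerm_le hρ0 hρ a x k).trans
        (mul_le_mul_of_nonneg_left (norm_le_pi_norm a (x k)) (pow_nonneg hρ0 k))
  exact (continuous_codingTerm T k).comp (Continuous.prodMk_right a)

lemma map_coding_closedBall (hρ0 : 0 ≤ ρ) (hρ1 : ρ < 1 / 2) (hρ : ∀ i, opNorm (T i) ≤ ρ)
    (a : Fin m → E d) (x : Shift m) (r : ℝ) :
    μ.map (coding T a) (Metric.closedBall (coding T a x) r) = μ (near T a x r) := by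
  rw [Measure.map_apply (continuous_coding hρ0 hρ1 hρ a).measurable measurableSet_closedBall]
  congr 1
  ext y
  rw [Set.mem_preimage, Metric.mem_closedBall, dist_comm, dist_eq_norm]
  rfl

/-- The exponent `log G_μ(x, r) / log r`. -/
def logG (T : Fin m → Matrix (Fin d) (Fin d) ℝ) (μ : Measure (Shift m)) (x : Shift m) (r : ℝ) :
    ℝ :=
  Real.log (G T μ x r) / Real.log r

lemma eventually_pos_lt_one : ∀ᶠ r in 𝓝[>] (0 : ℝ), 0 < r ∧ r < 1 :=
  Ioo_mem_nhdsGT one_pos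

lemma coe_ennreal_natCast_eq (n : ℕ) : ((n : ℝ≥0∞) : EReal) = ((n : ℝ) : EReal) := by
  rw [← ENNReal.ofReal_natCast, EReal.coe_ennreal_ofReal, max_eq_left n.cast_nonneg]


/-- Some admissible exponent lies below `t`, and `φ` decreases in the exponent; uniqueness of the
exponent plays no role. -/
lemma svFun_le_of_S_lt (hT : ∀ i, IsUnit (T i)) (hρ0 : 0 ≤ ρ) (hρ1 : ρ < 1 / 2)
    (hρ : ∀ i, opNorm (T i) ≤ ρ) {t : ℝ} (ht : 0 ≤ t) (htd : t < d) {n : ℕ} {x : Shift m}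
    (h : S T μ n x < ENNReal.ofReal t) : svFun t (wordMat T x n) ≤ μ.real (cyl x n) := by
  obtain ⟨s, hs, hst⟩ := sInf_lt_iff.1 h
  have hs' : svFunExt s (wordMat T x n) = μ.real (cyl x n) := hs
  rw [svFunExt, if_neg hst.ne_top] at hs'
  rw [← hs']
  exact svFun_anti (isUnit_wordMat hT x n)
    ((opNorm_wordMat_le hρ0 hρ x n).trans (pow_le_one₀ hρ0 (by linarith)))
    ENNReal.toReal_nonneg (ENNReal.toReal_le_of_le_ofReal ht hst.le) htd

lemma liminf_logG_le_D (x : Shift m) :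
    liminf (fun r => (logG T μ x r : EReal)) (𝓝[>] 0) ≤ D T μ x :=
  liminf_le_limsup

variable [IsProbabilityMeasure μ]

lemma ae_ae_locDim_eq (hT : ∀ i, IsUnit (T i)) (hρ0 : 0 ≤ ρ) (hρ1 : ρ < 1 / 2)
    (hρ : ∀ i, opNorm (T i) ≤ ρ) :
    ∀ᵐ a : Fin m → E d, ∀ᵐ x ∂μ,
      lowerLocDim (μ.map (coding T a)) (coding T a x)
        = liminf (fun r => (logG T μ x r : EReal)) (𝓝[>] 0) ∧
      upperLocDim (μ.map (coding T a)) (coding T a x) = D T μ x := by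
  filter_upwards [ae_ae_eventually_measure_near_comparable (d := d) (μ := μ) hT hρ0 hρ1 hρ]
    with a ha
  filter_upwards [ha] with x hx
  have hGm : ∀ r r' : ℝ, 0 < r → r ≤ r' → G T μ x r ≤ G T μ x r' :=
    fun r r' hr h => G_mono x hr.le h
  have hG0 : ∀ r : ℝ, 0 < r → 0 < G T μ x r := fun r hr => G_pos hT hρ0 hρ1 hρ x hr
  have hNm : ∀ r r' : ℝ, 0 < r → r ≤ r' → μ.real (near T a x r) ≤ μ.real (near T a x r') :=
    fun r r' _ h => measureReal_mono (fun y hy => le_trans hy h)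
  have hG2 : ∀ r : ℝ, 0 < r → G T μ x (2 * r) ≤ 2 ^ d * G T μ x r :=
    fun r hr => G_two_mul_le x hr.le
  have h1 : ∀ ε : ℝ, 0 < ε → ∀ᶠ r in 𝓝[>] (0 : ℝ), μ.real (near T a x r) ≤ r ^ (-ε) * G T μ x r :=
    fun ε hε => eventually_le_rpow_mul_of_doubling_right zero_le_one hNm hGm
      (fun r hr => (hG0 r hr).le) hG2 (hx.mono fun n hn => by rw [one_mul]; exact hn.1) hε
  have h2 : ∀ ε : ℝ, 0 < ε → ∀ᶠ r in 𝓝[>] (0 : ℝ), G T μ x r ≤ r ^ (-ε) * μ.real (near T a x r) :=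
    fun ε hε => eventually_le_rpow_mul_of_doubling_left hGm hNm
      (fun r hr => (hG0 r hr).le) (fun r _ => measureReal_nonneg) hG2 (hx.mono fun n hn => hn.2) hε
  -- The lower bound by the positive `G` excludes `log 0`, so the quotient is eventually a real
  -- number.
  have hN0 : ∀ᶠ r in 𝓝[>] (0 : ℝ), 0 < μ.real (near T a x r) := by
    filter_upwards [h2 1 one_pos, eventually_pos_lt_one] with r hr hr0
    exact pos_of_mul_pos_right ((hG0 r hr0.1).trans_le hr) (Real.rpow_nonneg hr0.1.le _)
  let f : ℝ → ℝ := fun r => Real.log (μ.real (near T a x r)) / Real.log r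
  have hf : logRatio (μ.map (coding T a)) (coding T a x) =ᶠ[𝓝[>] 0] fun r => (f r : EReal) := by
    filter_upwards [hN0] with r hr
    rw [logRatio, map_coding_closedBall hρ0 hρ1 hρ, ENNReal.log_pos_real' hr, ← EReal.coe_div]
    rfl
  have h3 : ∀ ε > 0, ∀ᶠ r in 𝓝[>] (0 : ℝ), logG T μ x r ≤ f r + ε := by
    intro ε hε
    filter_upwards [h1 ε hε, hN0, eventually_pos_lt_one] with r hr hr' hr0
    exact log_div_log_le_add_of_le_rpow_mul hr' (hG0 r hr0.1) hr0.1 hr0.2 hr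
  have h4 : ∀ ε > 0, ∀ᶠ r in 𝓝[>] (0 : ℝ), f r ≤ logG T μ x r + ε := by
    intro ε hε
    filter_upwards [h2 ε hε, hN0, eventually_pos_lt_one] with r hr hr' hr0
    exact log_div_log_le_add_of_le_rpow_mul (hG0 r hr0.1) hr' hr0.1 hr0.2 hr
  constructor
  · rw [lowerLocDim, liminf_congr hf]
    exact le_antisymm (liminf_coe_le_of_eventually_le_add h4)
      (liminf_coe_le_of_eventually_le_add h3)
  · rw [upperLocDim, limsup_congr hf]
    exact le_antisymm (limsup_coe_le_of_eventually_le_add h4)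
      (limsup_coe_le_of_eventually_le_add h3)

lemma eventually_logG_mem_Icc (hT : ∀ i, IsUnit (T i)) (hρ0 : 0 ≤ ρ) (hρ1 : ρ < 1 / 2)
    (hρ : ∀ i, opNorm (T i) ≤ ρ) (x : Shift m) :
    ∀ᶠ r in 𝓝[>] (0 : ℝ), logG T μ x r ∈ Set.Icc 0 (d : ℝ) := by
  filter_upwards [eventually_pos_lt_one] with r hr
  have hlog := Real.log_neg hr.1 hr.2
  have hG := G_pos (μ := μ) hT hρ0 hρ1 hρ x hr.1
  constructor
  · exact div_nonneg_of_nonpos (Real.log_nonpos hG.le (G_le_one x hr.1.le)) hlog.le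
  · rw [logG, div_le_iff_of_neg hlog, ← Real.log_pow]
    exact Real.log_le_log (pow_pos hr.1 d) (pow_le_G hT hρ0 hρ1 hρ x hr.1.le hr.2.le)

lemma D_le (hT : ∀ i, IsUnit (T i)) (hρ0 : 0 ≤ ρ) (hρ1 : ρ < 1 / 2)
    (hρ : ∀ i, opNorm (T i) ≤ ρ) (x : Shift m) : D T μ x ≤ ((d : ℝ) : EReal) := by
  refine limsup_le_of_le (by isBoundedDefault) ?_
  filter_upwards [eventually_logG_mem_Icc (μ := μ) hT hρ0 hρ1 hρ x] with r hr
  exact EReal.coe_le_coe_iff.2 hr.2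

/-- Otherwise `φ^t < μ [x|n] ≤ 1`, and an intermediate value produces an admissible exponent at most
`t`. -/
lemma le_svFun_of_lt_S (hT : ∀ i, IsUnit (T i)) {t : ℝ} (ht : 0 ≤ t) (htd : t < d) {n : ℕ}
    {x : Shift m} (h : ENNReal.ofReal t < S T μ n x) :
    μ.real (cyl x n) ≤ svFun t (wordMat T x n) := by
  by_contra hlt
  obtain ⟨s, hs0, hst, hs⟩ := exists_svFun_eq (isUnit_wordMat hT x n) ht htd (not_le.1 hlt).le
    measureReal_le_one
  refine h.not_ge ((sInf_le ?_).trans (ENNReal.ofReal_le_ofReal hst))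
  change svFunExt (ENNReal.ofReal s) (wordMat T x n) = μ.real (cyl x n)
  rw [svFunExt, if_neg ENNReal.ofReal_ne_top, ENNReal.toReal_ofReal hs0, hs]

lemma liminf_logG_le_of_liminf_S_lt (hT : ∀ i, IsUnit (T i)) (hρ0 : 0 ≤ ρ) (hρ1 : ρ < 1 / 2)
    (hρ : ∀ i, opNorm (T i) ≤ ρ) {t : ℝ} (ht : 0 ≤ t) (htd : t < d) {x : Shift m}
    (h : liminf (fun n => S T μ n x) atTop < ENNReal.ofReal t) :
    liminf (fun r => (logG T μ x r : EReal)) (𝓝[>] 0) ≤ (t : EReal) := by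
  have hfr : ∃ᶠ n in atTop, S T μ n x < ENNReal.ofReal t :=
    frequently_lt_of_liminf_lt (by isBoundedDefault) h
  -- At these radii `zfun * φ^t = r ^ t` holds exactly.
  let r : ℕ → ℝ := fun n => sv (wordMat T x n) ⌊t⌋₊
  have hr0 : ∀ n, 0 < r n := fun n => sv_pos (isUnit_wordMat hT x n) ((Nat.floor_lt ht).2 htd)
  have hr1 : ∀ n, r n ≤ (1 / 2) ^ n := fun n =>
    (sv_le_opNorm _ _).trans (opNorm_wordMat_le_half hρ0 hρ1 hρ x n)
  have hlim : Tendsto r atTop (𝓝[>] 0) := by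
    refine tendsto_nhdsWithin_iff.2 ⟨?_, Eventually.of_forall hr0⟩
    exact squeeze_zero (fun n => (hr0 n).le) hr1
      (tendsto_pow_atTop_nhds_zero_of_lt_one (by norm_num) (by norm_num))
  refine liminf_le_of_frequently_le ?_ (by isBoundedDefault)
  refine hlim.frequently ((hfr.and_eventually (eventually_ge_atTop 1)).mono ?_)
  rintro n ⟨hn, hn1⟩
  have hr2 : r n < 1 := (hr1 n).trans_lt (pow_lt_one₀ (by norm_num) (by norm_num) (by omega))
  have hle : r n ^ t ≤ G T μ x (r n) := by
    rw [← zfun_mul_svFun_eq (isUnit_wordMat hT x n) ht htd, mul_comm]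
    exact (mul_le_mul_of_nonneg_right (svFun_le_of_S_lt hT hρ0 hρ1 hρ ht htd hn)
      (zfun_nonneg _ (hr0 n).le)).trans
        (measureReal_cyl_mul_zfun_le_G hT hρ0 hρ1 hρ x n (hr0 n).le)
  rw [EReal.coe_le_coe_iff, logG, div_le_iff_of_neg (Real.log_neg (hr0 n) hr2),
    ← Real.log_rpow (hr0 n)]
  exact Real.log_le_log (Real.rpow_pos_of_pos (hr0 n) _) hle

lemma le_liminf_logG_of_lt_liminf_S (hT : ∀ i, IsUnit (T i)) (hρ0 : 0 ≤ ρ) (hρ1 : ρ < 1 / 2)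
    (hρ : ∀ i, opNorm (T i) ≤ ρ) {t : ℝ} (ht : 0 ≤ t) (htd : t < d) {x : Shift m}
    (h : ENNReal.ofReal t < liminf (fun n => S T μ n x) atTop) :
    (t : EReal) ≤ liminf (fun r => (logG T μ x r : EReal)) (𝓝[>] 0) := by
  obtain ⟨N, hN⟩ := eventually_atTop.1 (eventually_lt_of_lt_liminf h)
  have hφ : ∀ n, 0 < svFun t (wordMat T x n) := fun n => svFun_pos (isUnit_wordMat hT x n) ht htd
  -- The constant absorbs the finitely many prefix lengths below `N`, where nothing is known about
  -- `S`.
  let C : ℝ := 1 + ∑ n ∈ Finset.range N, (svFun t (wordMat T x n))⁻¹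
  have hsum0 : 0 ≤ ∑ n ∈ Finset.range N, (svFun t (wordMat T x n))⁻¹ :=
    Finset.sum_nonneg fun n _ => (inv_pos.2 (hφ n)).le
  have hC0 : 0 ≤ C := by positivity
  have hC : ∀ n, μ.real (cyl x n) ≤ C * svFun t (wordMat T x n) := by
    intro n
    rcases lt_or_ge n N with hn | hn
    · refine measureReal_le_one.trans ?_
      rw [← inv_le_iff_one_le_mul₀ (hφ n)]
      have := Finset.single_le_sum (f := fun n => (svFun t (wordMat T x n))⁻¹)
        (fun n _ => (inv_pos.2 (hφ n)).le) (Finset.mem_range.2 hn)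
      simp only [C]
      linarith
    · refine (le_svFun_of_lt_S hT ht htd (hN n hn)).trans
        (le_mul_of_one_le_left (hφ n).le ?_)
      simp only [C]
      linarith
  have hG : ∀ n : ℕ, G T μ x ((1 / 2) ^ n) ≤ C * ((n : ℝ) + 1) ^ 4 * ((1 / 2 : ℝ) ^ n) ^ t := by
    intro n
    have hr : (0 : ℝ) < (1 / 2) ^ n := by positivity
    have hH : H T μ n x ≤ ENNReal.ofReal (((n : ℝ) + 1) * (C * ((1 / 2 : ℝ) ^ n) ^ t)) := by
      have hj : ∀ j ∈ Finset.range (n + 1),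
          μ (cyl x j) * ENNReal.ofReal (zfun (wordMat T x j) ((1 / 2) ^ n))
            ≤ ENNReal.ofReal (C * ((1 / 2 : ℝ) ^ n) ^ t) := by
        intro j _
        rw [← ofReal_measureReal, ← ENNReal.ofReal_mul measureReal_nonneg]
        refine ENNReal.ofReal_le_ofReal ?_
        calc μ.real (cyl x j) * zfun (wordMat T x j) ((1 / 2) ^ n)
            ≤ C * svFun t (wordMat T x j) * zfun (wordMat T x j) ((1 / 2) ^ n) :=
              mul_le_mul_of_nonneg_right (hC j) (zfun_nonneg _ hr.le)
          _ = C * (zfun (wordMat T x j) ((1 / 2) ^ n) * svFun t (wordMat T x j)) := by ring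
          _ ≤ _ := mul_le_mul_of_nonneg_left
              (zfun_mul_svFun_le (isUnit_wordMat hT x j) ht htd hr) hC0
      refine (Finset.sum_le_sum hj).trans (le_of_eq ?_)
      rw [Finset.sum_const, Finset.card_range, nsmul_eq_mul,
        ENNReal.ofReal_mul (p := (n : ℝ) + 1) (by positivity), ← Nat.cast_succ, ENNReal.ofReal_natCast]
    have h1 := (ENNReal.ofReal_le_ofReal_iff (by positivity)).1
      ((ofReal_G_le_H hT hρ0 hρ1 hρ n x).trans hH)
    refine h1.trans ?_
    have h2 : (n : ℝ) + 1 ≤ ((n : ℝ) + 1) ^ 4 :=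
      le_self_pow₀ (by linarith [n.cast_nonneg (α := ℝ)]) (by norm_num)
    calc ((n : ℝ) + 1) * (C * ((1 / 2 : ℝ) ^ n) ^ t)
        ≤ ((n : ℝ) + 1) ^ 4 * (C * ((1 / 2 : ℝ) ^ n) ^ t) := by gcongr
      _ = _ := by ring
  have hev : ∀ ε > 0, ∀ᶠ r in 𝓝[>] (0 : ℝ), t ≤ logG T μ x r + ε := by
    intro ε hε
    have h1 := eventually_le_rpow_mul_of_doubling_right (f := G T μ x) (g := fun r => r ^ t)
      (K := 2 ^ t) hC0 (fun r r' hr hrr => G_mono x hr.le hrr)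
      (fun r r' hr hrr => Real.rpow_le_rpow hr.le hrr ht) (fun r hr => Real.rpow_nonneg hr.le t)
      (fun r hr => (Real.mul_rpow zero_le_two hr.le).le) (Eventually.of_forall hG) hε
    filter_upwards [h1, eventually_pos_lt_one] with r hr hr0
    have h2 := log_div_log_le_add_of_le_rpow_mul (G_pos (μ := μ) hT hρ0 hρ1 hρ x hr0.1)
      (Real.rpow_pos_of_pos hr0.1 t) hr0.1 hr0.2 hr
    rwa [Real.log_rpow hr0.1, mul_div_cancel_right₀ _ (Real.log_neg hr0.1 hr0.2).ne] at h2
  have h3 := liminf_coe_le_of_eventually_le_add hev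
  rwa [liminf_const] at h3

/-- Both one-sided bounds are confined to exponents `t < d`; beyond that, `G ≥ r ^ d` for small `r`
caps the exponent at `d`. -/
lemma liminf_logG_eq (hT : ∀ i, IsUnit (T i)) (hρ0 : 0 ≤ ρ) (hρ1 : ρ < 1 / 2)
    (hρ : ∀ i, opNorm (T i) ≤ ρ) (x : Shift m) :
    liminf (fun r => (logG T μ x r : EReal)) (𝓝[>] 0)
      = ((min (d : ℝ≥0∞) (liminf (fun n => S T μ n x) atTop) : ℝ≥0∞) : EReal) := by
  set L := liminf (fun n => S T μ n x) atTop
  have hmem := eventually_logG_mem_Icc (μ := μ) hT hρ0 hρ1 hρ x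
  have h0 : (0 : EReal) ≤ liminf (fun r => (logG T μ x r : EReal)) (𝓝[>] 0) :=
    le_liminf_of_le (by isBoundedDefault) (hmem.mono fun r hr => EReal.coe_nonneg.2 hr.1)
  refine le_antisymm ?_ ?_
  · rcases le_or_gt (d : ℝ≥0∞) L with hL | hL
    · rw [min_eq_left hL, coe_ennreal_natCast_eq]
      refine liminf_le_of_frequently_le ?_ (by isBoundedDefault)
      exact (hmem.mono fun r hr => EReal.coe_le_coe_iff.2 hr.2).frequently
    · rw [min_eq_right hL.le]
      obtain ⟨l, hl0, hl⟩ : ∃ l : ℝ, 0 ≤ l ∧ L = ENNReal.ofReal l :=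
        ⟨L.toReal, ENNReal.toReal_nonneg, (ENNReal.ofReal_toReal hL.ne_top).symm⟩
      have hld : l < d := by
        rw [hl, ← ENNReal.ofReal_natCast] at hL
        exact ENNReal.ofReal_lt_ofReal_iff_of_nonneg hl0 |>.1 hL
      rw [hl, EReal.coe_ennreal_ofReal, max_eq_left hl0]
      refine le_of_forall_gt_imp_ge_of_dense fun c hc => ?_
      obtain ⟨q, hlq, hqc⟩ := EReal.lt_iff_exists_real_btwn.1
        (lt_min hc (EReal.coe_lt_coe_iff.2 hld))
      have hlq := EReal.coe_lt_coe_iff.1 hlq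
      have hqd := EReal.coe_lt_coe_iff.1 (hqc.trans_le (min_le_right _ _))
      refine le_trans ?_ (hqc.trans_le (min_le_left _ _)).le
      refine liminf_logG_le_of_liminf_S_lt hT hρ0 hρ1 hρ (hl0.trans hlq.le) hqd ?_
      change L < _
      rw [hl]
      exact (ENNReal.ofReal_lt_ofReal_iff_of_nonneg hl0).2 hlq
  · refine le_of_forall_lt_imp_le_of_dense fun c hc => ?_
    obtain ⟨q, hcq, hq⟩ := EReal.lt_iff_exists_real_btwn.1 hc
    refine hcq.le.trans ?_
    rcases le_total q 0 with hq0 | hq0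
    · exact (EReal.coe_nonpos.2 hq0).trans h0
    have hq' : ENNReal.ofReal q < min (d : ℝ≥0∞) L := by
      rw [← EReal.coe_ennreal_lt_coe_ennreal_iff, EReal.coe_ennreal_ofReal, max_eq_left hq0]
      exact hq
    refine le_liminf_logG_of_lt_liminf_S hT hρ0 hρ1 hρ hq0 ?_ (hq'.trans_le (min_le_right _ _))
    have := hq'.trans_le (min_le_left _ _)
    rw [← ENNReal.ofReal_natCast] at this
    exact (ENNReal.ofReal_lt_ofReal_iff_of_nonneg hq0).1 this

end LocalDimensions

end

end SelfAffine

/-! ### The characterization of exact dimensionality -/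

theorem theorem1p2 {d m : ℕ} (hd : 1 ≤ d)
    (T : Fin m → Matrix (Fin d) (Fin d) ℝ)
    (hT_inv : ∀ i, IsUnit (T i))
    (hT_norm : ∀ i, SelfAffine.opNorm (T i) < 1 / 2)
    (μ : Measure (SelfAffine.Shift m)) [IsProbabilityMeasure μ] :
    (∀ᵐ a : Fin m → SelfAffine.E d,
        SelfAffine.ExactDimensional (μ.map (SelfAffine.coding T a))) ↔
      ((∀ᵐ x ∂μ, (d : ℝ≥0∞) ≤ liminf (fun n : ℕ => SelfAffine.S T μ n x) atTop) ∨
        ∃ s : ℝ, 0 ≤ s ∧ s < d ∧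
          ∀ᵐ x ∂μ, liminf (fun n : ℕ => SelfAffine.S T μ n x) atTop = ENNReal.ofReal s ∧
            SelfAffine.D T μ x = (s : EReal)) := by
  open SelfAffine in
  obtain ⟨ρ, hρ0, hρ1, hρ⟩ := exists_contraction_ratio hT_norm
  have hdim := ae_ae_locDim_eq (μ := μ) hT_inv hρ0 hρ1 hρ
  have hlow := liminf_logG_eq (μ := μ) hT_inv hρ0 hρ1 hρ
  constructor
  · intro h
    -- A single good parameter suffices, since the conclusion does not involve `a`.
    obtain ⟨a, ⟨C, hC⟩, ha⟩ := (h.and hdim).exists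
    have hC' : ∀ᵐ x ∂μ, ((min (d : ℝ≥0∞) (liminf (fun n => S T μ n x) atTop) : ℝ≥0∞) : EReal) = C
        ∧ D T μ x = C := by
      filter_upwards [ae_of_ae_map (continuous_coding hρ0 hρ1 hρ a).measurable.aemeasurable hC,
        ha] with x hx hx'
      rw [← hlow, ← hx'.1, ← hx'.2]
      exact hx
    have hC0 : 0 ≤ C := by
      obtain ⟨x, hx, -⟩ := hC'.exists
      exact EReal.coe_nonneg.1 (hx ▸ EReal.coe_ennreal_nonneg _)
    have hmin : ∀ᵐ x ∂μ,
        min (d : ℝ≥0∞) (liminf (fun n => S T μ n x) atTop) = ENNReal.ofReal C := by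
      filter_upwards [hC'] with x hx
      rw [← EReal.coe_ennreal_eq_coe_ennreal_iff, EReal.coe_ennreal_ofReal, max_eq_left hC0, hx.1]
    rcases lt_or_ge C d with hCd | hCd
    · right
      refine ⟨C, hC0, hCd, ?_⟩
      have hCd' : ENNReal.ofReal C < d := by
        rw [← ENNReal.ofReal_natCast]
        exact (ENNReal.ofReal_lt_ofReal_iff_of_nonneg hC0).2 hCd
      filter_upwards [hC', hmin] with x hx hx'
      refine ⟨?_, hx.2⟩
      rcases min_choice (d : ℝ≥0∞) (liminf (fun n => S T μ n x) atTop) with h' | h'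
      · exact absurd (h'.symm.trans hx') hCd'.ne'
      · exact h'.symm.trans hx'
    -- A minimum with `d` that equals `C ≥ d` forces the other entry to be at least `d`.
    · left
      filter_upwards [hmin] with x hx
      have hCd' : (d : ℝ≥0∞) ≤ ENNReal.ofReal C := by
        rw [← ENNReal.ofReal_natCast]
        exact ENNReal.ofReal_le_ofReal hCd
      exact hCd'.trans (hx ▸ min_le_right _ _)
  · intro h
    obtain ⟨C, hC⟩ : ∃ C : ℝ, ∀ᵐ x ∂μ,
        liminf (fun r => (logG T μ x r : EReal)) (𝓝[>] 0) = C ∧ D T μ x = C := by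
      rcases h with h | ⟨s, hs0, hsd, h⟩
      · refine ⟨d, ?_⟩
        filter_upwards [h] with x hx
        have h1 : liminf (fun r => (logG T μ x r : EReal)) (𝓝[>] 0) = ((d : ℝ) : EReal) := by
          rw [hlow, min_eq_left hx, coe_ennreal_natCast_eq]
        -- The limsup is squeezed between the liminf, which is `d`, and the general bound `D ≤ d`.
        exact ⟨h1, le_antisymm (D_le hT_inv hρ0 hρ1 hρ x) (h1 ▸ liminf_logG_le_D x)⟩
      · refine ⟨s, ?_⟩
        filter_upwards [h] with x hx
        refine ⟨?_, hx.2⟩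
        rw [hlow, hx.1, min_eq_right, EReal.coe_ennreal_ofReal, max_eq_left hs0]
        rw [← ENNReal.ofReal_natCast]
        exact ENNReal.ofReal_le_ofReal hsd.le
    filter_upwards [hdim] with a ha
    -- Compact regularity avoids having to show that the points with local dimension `C` form a
    -- measurable set.
    refine ⟨C, ae_map_of_ae_of_continuous (continuous_coding hρ0 hρ1 hρ a) ?_⟩
    filter_upwards [ha, hC] with x hx hx'
    rw [hx.1, hx.2]
    exact hx'
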